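/- Let $H$ and $U$ be real separable Hilbert spaces, let $(\Omega,\mathcal F,\{\mathcal F_t\}_{t\ge 0},\mathbb P)$ be a filtered probability space carrying a cylindrical Wiener process $W$ on $U$ with respect to $\{\mathcal F_t\}$, and let $\{f_k\}$ be an orthonormal basis of $U$. Let $A$ be a densely defined linear operator on $H$ generating a strongly continuous semigroup $S(t)$ with $\|S(t)x\|_H\le Me^{\omega t}\|x\|_H$ for all $t\ge 0$, $x\in H$, where $M\ge 1$ and $\omega\in\mathbb R$; let $Q^{1/2}:U\to H$ be Hilbert–Schmidt and $u_0\in H$. Fix $T>0$, let $$u(T)=S(T)u_0+\int_0^T S(T-s)Q^{1/2}\,dW_s$$ be the mild solution at time $T$ of $du=Au\,dt+Q^{1/2}dW_t$, $u(0)=u_0$, and let $$\gamma_{u(T)}=\int_0^T S(s)Q^{1/2}(Q^{1/2})^*S(s)^*\,ds$$ be its Malliavin covariance operator, with Moore–Penrose pseudoinverse $\gamma_{u(T)}^\dagger$, whose domain is $\operatorname{Ran}\gamma_{u(T)}\oplus(\operatorname{Ran}\gamma_{u(T)})^\perp$. For $h$ in this domain (in particular, for every $h\in\operatorname{Ran}\gamma_{u(T)}$)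 define the covering vector field $$v_h(r)=(Q^{1/2})^*S(T-r)^*\gamma_{u(T)}^\dagger h,\qquad r\in[0,T].$$ For $F\in\mathbb D^{1,2}$ (the closure of the smooth cylindrical functionals of $W$ on $[0,T]$) let $DF\in L^2(\Omega;L^2([0,T];U))$ be its Malliavin derivative, and let the Skorokhod integral $\delta$ be the adjoint of $D$ in $L^2(\Omega,\sigma(W_s:s\le T),\mathbb P)$. Then: 1. $v_h$ is a deterministic $U$-valued process, it is adapted to $\{\mathcal F_r\}$, it belongs to $L^2([0,T];U)$, and $$\int_0^T\|v_h(r)\|_U^2\,dr\le\|Q^{1/2}\|_{\mathrm{HS}}^2\,M^2\,\|\gamma_{u(T)}^\dagger h\|_H^2\cdot\begin{cases}\dfrac{|e^{2\omega T}-1|}{2|\omega|},&\omega\ne 0,\\[2mm] T,&\omega=0.\end{cases}$$ 2. $v_h$ is Skorokhod integrable and Itô integrable on $[0,T]$, and the Skorokhod integral coincides with the Itô integral, and with the Wiener integral given by its series expansion along the basis: $$\delta(v_h)=\int_0^T\langle v_h(r),dW_r\rangle_U=\sum_k\int_0^T\langle v_h(r),f_k\rangle_U\,d\langle W,f_k\rangle_r\quad\text{in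 }L^2(\Omega).$$ 3. The solution $u(T)$ has the Malliavin derivative $D_ru(T)=S(T-r)Q^{1/2}$, $r\in[0,T]$ (that is, $\int_0^T\|D_ru(T)\|_{\mathrm{HS}}^2\,dr<\infty$, and $D_r\langle u(T),z\rangle_H=(D_ru(T))^*z$ for all $z\in H$), and the $H$-valued pairing of $Du(T)$ with $v_h$ (determined by $\langle\langle Du(T),v_h\rangle_{H_W},z\rangle_H=\langle D\langle u(T),z\rangle_H,v_h\rangle_{H_W}$ for all $z\in H$, where $H_W=L^2([0,T];U)$) is the Bochner integral $$\langle Du(T),v_h\rangle_{H_W}=\int_0^T D_ru(T)\,v_h(r)\,dr .$$ -/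

import Mathlib

open MeasureTheory ProbabilityTheory Filter Topology
open scoped NNReal ENNReal InnerProductSpace

noncomputable section

namespace LinearSPDE

/-! ## Semigroups and operators on Hilbert spaces -/

section Operators

variable {H U : Type*} [NormedAddCommGroup H] [InnerProductSpace ℝ H]
  [NormedAddCommGroup U] [InnerProductSpace ℝ U]

/-- Strongly continuous one-parameter semigroups of bounded operators. -/
structure IsC0Semigroup (S : ℝ≥0 → H →L[ℝ] H) : Prop where
  map_zero : S 0 = ContinuousLinearMap.id ℝ H
  map_add : ∀ s t, S (s + t) = (S s).comp (S t)
  continuous_apply : ∀ x, Continuous fun t => S t x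

/-- `A` is the infinitesimal generator of `S`: its domain consists of all `x` for which
`t⁻¹ (S t x - x)` converges as `t ↓ 0`, and `A x` is the limit. -/
def IsGenerator (A : H →ₗ.[ℝ] H) (S : ℝ≥0 → H →L[ℝ] H) : Prop :=
  ∀ x y : H, (x, y) ∈ A.graph ↔
    Tendsto (fun t : ℝ≥0 => (t : ℝ)⁻¹ • (S t x - x)) (𝓝[>] 0) (𝓝 y)

/-- `R` is Hilbert-Schmidt, expressed through an orthonormal basis of its domain. -/
def IsHilbertSchmidt {ι : Type*} (f : HilbertBasis ι ℝ U) (R : U →L[ℝ] H) : Prop :=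
  Summable fun k => ‖R (f k)‖ ^ 2

/-- The square of the Hilbert-Schmidt norm of a Hilbert-Schmidt operator. -/
def hsNormSq {ι : Type*} (f : HilbertBasis ι ℝ U) (R : U →L[ℝ] H) : ℝ :=
  ∑' k, ‖R (f k)‖ ^ 2

/-- The graph of the Moore-Penrose pseudoinverse of a bounded operator `R`: pairs `(h, x)` such that
`x` is orthogonal to `ker R` and `h - R x` is orthogonal to `Ran R`
(so that `R x` is the orthogonal projection of `h` to the closure of `Ran R`). -/
def pinvGraph (R : H →L[ℝ] H) : Submodule ℝ (H × H) where
  carrier := {p | (∀ y, R y = 0 → ⟪p.2, y⟫_ℝ = 0) ∧ ∀ y, ⟪p.1 - R p.2, R y⟫_ℝ = 0}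
  add_mem' := by
    rintro p q ⟨hp, hp'⟩ ⟨hq, hq'⟩
    refine ⟨fun y hy => ?_, fun y => ?_⟩
    · simp [inner_add_left, hp y hy, hq y hy]
    · have h : (p + q).1 - R (p + q).2 = (p.1 - R p.2) + (q.1 - R q.2) := by
        simp only [Prod.fst_add, Prod.snd_add, map_add]; abel
      rw [h, inner_add_left, hp' y, hq' y, add_zero]
  zero_mem' := by simp
  smul_mem' := by
    rintro c p ⟨hp, hp'⟩
    refine ⟨fun y hy => ?_, fun y => ?_⟩
    · simp [inner_smul_left, hp y hy]
    · have h : (c • p).1 - R (c • p).2 = c • (p.1 - R p.2) := by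
        simp only [Prod.smul_fst, Prod.smul_snd, map_smul, smul_sub]
      rw [h, inner_smul_left, hp' y, mul_zero]

theorem pinvGraph_functional (R : H →L[ℝ] H) (p : H × H) (hp : p ∈ pinvGraph R) (h0 : p.1 = 0) :
    p.2 = 0 := by
  obtain ⟨h1, h2⟩ := hp
  have h3 : R p.2 = 0 := by
    have h4 := h2 p.2
    rw [h0, zero_sub, inner_neg_left, neg_eq_zero] at h4
    exact inner_self_eq_zero.mp h4
  exact inner_self_eq_zero.mp (h1 p.2 h3)

/-- The Moore-Penrose pseudoinverse of a bounded operator on a Hilbert space, as a (possibly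
unbounded) partially defined operator. Its domain is `Ran R + (Ran R)ᗮ`. -/
def pinv (R : H →L[ℝ] H) : H →ₗ.[ℝ] H := (pinvGraph R).toLinearPMap

theorem pinv_graph (R : H →L[ℝ] H) : (pinv R).graph = pinvGraph R :=
  Submodule.toLinearPMap_graph_eq _ (pinvGraph_functional R)

variable [CompleteSpace H] [CompleteSpace U]

/-- The Malliavin covariance operator `∫₀ᵀ S(s) Q^{1/2} (Q^{1/2})* S(s)* ds`;
`R` stands for `Q^{1/2}`. -/
def malliavinCovariance (S : ℝ≥0 → H →L[ℝ] H) (R : U →L[ℝ] H) (T : ℝ≥0) : H →L[ℝ] H :=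
  ∫ s in (0 : ℝ)..T, (S s.toNNReal).comp (R.comp
    ((ContinuousLinearMap.adjoint R).comp (ContinuousLinearMap.adjoint (S s.toNNReal))))

/-- The covering vector field `v_h(r) = (Q^{1/2})* S(T - r)* γ† h`, `r ∈ [0, T]`, for `h` in the
domain of the pseudoinverse `γ†` of the Malliavin covariance operator. -/
def coveringField (S : ℝ≥0 → H →L[ℝ] H) (R : U →L[ℝ] H) (T : ℝ≥0)
    (h : (pinv (malliavinCovariance S R T)).domain) (r : ℝ) : U :=
  ContinuousLinearMap.adjoint R
    (ContinuousLinearMap.adjoint (S (T - r).toNNReal) (pinv (malliavinCovariance S R T) h))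

end Operators

/-! ## The cylindrical Wiener process and integrals against it -/

/-- Lebesgue measure on `[0, T]`. -/
abbrev timeMeasure (T : ℝ≥0) : Measure ℝ := volume.restrict (Set.Icc (0 : ℝ) T)

/-- The Cameron-Martin space `L²([0, T]; U)`. -/
abbrev CameronMartin (U : Type*) [NormedAddCommGroup U] [InnerProductSpace ℝ U] (T : ℝ≥0) :=
  Lp U 2 (timeMeasure T)

section Wiener

variable {Ω : Type*} {mΩ : MeasurableSpace Ω}
  {U : Type*} [NormedAddCommGroup U] [InnerProductSpace ℝ U]
  {K : Type*} [NormedAddCommGroup K] [InnerProductSpace ℝ K]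
  {ι : Type*}

/-- `W t u`, formally `⟨W_t, u⟩`, is a cylindrical Wiener process on `U` with respect to the
filtration `𝓕`. -/
structure IsCylindricalWiener (W : ℝ≥0 → U → Ω → ℝ) (𝓕 : Filtration ℝ≥0 mΩ) (P : Measure Ω) :
    Prop where
  linear : ∀ t (a b : ℝ) (u v : U),
    W t (a • u + b • v) =ᵐ[P] fun ω => a * W t u ω + b * W t v ω
  brownian : ∀ u, ‖u‖ = 1 → IsBrownianReal (fun t => W t u) P
  adapted : ∀ t u, Measurable[𝓕 t] (W t u)
  indep : ∀ s t, s ≤ t → ∀ u,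
    Indep (MeasurableSpace.comap (fun ω => W t u ω - W s u ω) inferInstance) (𝓕 s) P

/-- The pairs `(φ, ∫₀ᵀ φ dB)` for deterministic step functions `φ : [0, T] → K`. -/
def stepGraph (B : ℝ≥0 → Ω → ℝ) (P : Measure Ω) (T : ℝ≥0) :
    Set (Lp K 2 (timeMeasure T) × Lp K 2 P) :=
  {p | ∃ (n : ℕ) (s t : Fin n → ℝ≥0) (y : Fin n → K),
    (∀ i, s i ≤ t i ∧ t i ≤ T) ∧
    (p.1 =ᵐ[timeMeasure T]
      fun r => ∑ i, (Set.Ioc (s i : ℝ) (t i)).indicator (fun _ => y i) r) ∧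
    (p.2 =ᵐ[P] fun ω => ∑ i, (B (t i) ω - B (s i) ω) • y i)}

/-- `X = ∫₀ᵀ φ(s) dB(s)` for a deterministic square integrable `φ : [0, T] → K` and a real Brownian
motion `B`: the closure of the integral of step functions. -/
def IsScalarWienerIntegral (B : ℝ≥0 → Ω → ℝ) (P : Measure Ω) (T : ℝ≥0) (φ : ℝ → K)
    (X : Lp K 2 P) : Prop :=
  ∃ hφ : MemLp φ 2 (timeMeasure T), (hφ.toLp φ, X) ∈ closure (stepGraph B P T)

/-- `X = ∫₀ᵀ Φ(s) dW_s = ∑ⱼ ∫₀ᵀ Φ(s) fⱼ dBⱼ(s)`, where `Bⱼ = ⟨W, fⱼ⟩` and `Φ` is a deterministic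
operator-valued integrand; the series converges in `L²(Ω; K)`. -/
def IsWienerIntegral (W : ℝ≥0 → U → Ω → ℝ) (P : Measure Ω) (T : ℝ≥0) (f : HilbertBasis ι ℝ U)
    (Φ : ℝ → U →L[ℝ] K) (X : Lp K 2 P) : Prop :=
  ∃ I : ι → Lp K 2 P,
    (∀ j, IsScalarWienerIntegral (fun t => W t (f j)) P T (fun s => Φ s (f j)) (I j)) ∧
    HasSum I X

/-- `X = W(h) = ∫₀ᵀ ⟨h(s), dW_s⟩` for `h ∈ L²([0, T]; U)`. -/
def IsIsonormal (W : ℝ≥0 → U → Ω → ℝ) (P : Measure Ω) (T : ℝ≥0) (f : HilbertBasis ι ℝ U)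
    (h : CameronMartin U T) (X : Lp ℝ 2 P) : Prop :=
  IsWienerIntegral W P T f (fun s => innerSL ℝ (h s)) X

/-- The pairs `(v, ∫₀ᵀ ⟨v, dW⟩)` for elementary integrands `v = ∑ᵢ ξᵢ 1_(sᵢ, tᵢ] uᵢ`, where `ξᵢ` is
bounded and `𝓕 sᵢ`-measurable. -/
def elementaryItoGraph (W : ℝ≥0 → U → Ω → ℝ) (𝓕 : Filtration ℝ≥0 mΩ) (P : Measure Ω) (T : ℝ≥0) :
    Set (Lp (CameronMartin U T) 2 P × Lp ℝ 2 P) :=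
  {p | ∃ (n : ℕ) (s t : Fin n → ℝ≥0) (u : Fin n → U) (ξ : Fin n → Ω → ℝ),
    (∀ i, s i ≤ t i ∧ t i ≤ T) ∧
    (∀ i, Measurable[𝓕 (s i)] (ξ i) ∧ ∃ C : ℝ, ∀ ω, |ξ i ω| ≤ C) ∧
    (∀ᵐ ω ∂P, (p.1 ω : CameronMartin U T) =ᵐ[timeMeasure T]
      fun r => ∑ i, (Set.Ioc (s i : ℝ) (t i)).indicator (fun _ => ξ i ω • u i) r) ∧
    (p.2 =ᵐ[P] fun ω => ∑ i, ξ i ω * (W (t i) (u i) ω - W (s i) (u i) ω))}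

/-- `v` is Itô integrable on `[0, T]` and `X = ∫₀ᵀ ⟨v(r), dW_r⟩` is its Itô integral: the closure in
`L²` of the integral of elementary integrands. -/
def IsItoIntegral (W : ℝ≥0 → U → Ω → ℝ) (𝓕 : Filtration ℝ≥0 mΩ) (P : Measure Ω) (T : ℝ≥0)
    (v : Lp (CameronMartin U T) 2 P) (X : Lp ℝ 2 P) : Prop :=
  (v, X) ∈ closure (elementaryItoGraph W 𝓕 P T)

/-! ## Malliavin derivative and Skorokhod integral -/

/-- The pairs `(F, DF)` for smooth cylindrical functionals `F = g(W(h₁), …, W(hₙ))`, where `g` is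
smooth and all its derivatives have at most polynomial growth, and
`DF = ∑ᵢ ∂ᵢ g(W(h₁), …, W(hₙ)) hᵢ`. -/
def cylindricalGraph (W : ℝ≥0 → U → Ω → ℝ) (P : Measure Ω) (T : ℝ≥0) (f : HilbertBasis ι ℝ U) :
    Set (Lp ℝ 2 P × Lp (CameronMartin U T) 2 P) :=
  {p | ∃ (n : ℕ) (h : Fin n → CameronMartin U T) (X : Fin n → Lp ℝ 2 P) (g : (Fin n → ℝ) → ℝ),
    (∀ i, IsIsonormal W P T f (h i) (X i)) ∧
    g.HasTemperateGrowth ∧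
    (p.1 =ᵐ[P] fun ω => g (fun i => X i ω)) ∧
    (p.2 =ᵐ[P] fun ω => ∑ i, fderiv ℝ g (fun i => X i ω) (Pi.single i 1) • h i)}

/-- `F ∈ 𝔻^{1,2}` and `G = DF` is its Malliavin derivative: the closure of the derivative of smooth
cylindrical functionals in the norm `(E[F²] + E[‖DF‖²])^{1/2}`. -/
def HasMalliavinDeriv (W : ℝ≥0 → U → Ω → ℝ) (P : Measure Ω) (T : ℝ≥0) (f : HilbertBasis ι ℝ U)
    (F : Lp ℝ 2 P) (G : Lp (CameronMartin U T) 2 P) : Prop :=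
  (F, G) ∈ closure (cylindricalGraph W P T f)

/-- The σ-algebra generated by the noise on `[0, T]`. -/
abbrev noiseSigma (W : ℝ≥0 → U → Ω → ℝ) (T : ℝ≥0) : MeasurableSpace Ω :=
  ⨆ (t : ℝ≥0) (_ : t ≤ T) (u : U), MeasurableSpace.comap (W t u) inferInstance

/-- `v ∈ Dom δ` and `X = δ(v)`: the Skorokhod integral is the adjoint of the Malliavin derivative.
Malliavin calculus takes place in `L²` of the σ-algebra generated by the noise, in which
`𝔻^{1,2}` is dense, so `δ(v)` is measurable with respect to that σ-algebra up to null sets. -/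
def IsSkorokhodIntegral (W : ℝ≥0 → U → Ω → ℝ) (P : Measure Ω) (T : ℝ≥0) (f : HilbertBasis ι ℝ U)
    (v : Lp (CameronMartin U T) 2 P) (X : Lp ℝ 2 P) : Prop :=
  AEStronglyMeasurable[noiseSigma W T] X P ∧
  ∀ (F : Lp ℝ 2 P) (G : Lp (CameronMartin U T) 2 P), HasMalliavinDeriv W P T f F G →
    ∫ ω, ⟪G ω, v ω⟫_ℝ ∂P = ∫ ω, F ω * X ω ∂P

variable [CompleteSpace U] [CompleteSpace K]

/-- The operator-valued field `DY ω r = D_r Y(ω) : U → K` is the Malliavin derivative of the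
Hilbert-space valued `Y ∈ L²(Ω; K)`: it has square integrable Hilbert-Schmidt norm, and
`D_r ⟨Y, z⟩ = (D_r Y)* z` for every `z`. -/
def IsMalliavinDerivField (W : ℝ≥0 → U → Ω → ℝ) (P : Measure Ω) (T : ℝ≥0) (f : HilbertBasis ι ℝ U)
    (Y : Lp K 2 P) (DY : Ω → ℝ → U →L[ℝ] K) : Prop :=
  (∀ j, AEStronglyMeasurable (fun p : Ω × ℝ => DY p.1 p.2 (f j)) (P.prod (timeMeasure T))) ∧
  (∫⁻ p, ∑' j, ‖DY p.1 p.2 (f j)‖ₑ ^ 2 ∂(P.prod (timeMeasure T)) < ∞) ∧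
  ∀ z : K, ∃ (F : Lp ℝ 2 P) (G : Lp (CameronMartin U T) 2 P),
    (F =ᵐ[P] fun ω => ⟪Y ω, z⟫_ℝ) ∧
    (∀ᵐ ω ∂P, (G ω : CameronMartin U T) =ᵐ[timeMeasure T]
      fun r => ContinuousLinearMap.adjoint (DY ω r) z) ∧
    HasMalliavinDeriv W P T f F G

/-- `p` is the `K`-valued pairing `⟨DY, v⟩` of the Malliavin derivative of `Y ∈ L²(Ω; K)` with
`v ∈ L²([0, T]; U)`, that is, `⟨p, z⟩ = ⟨D⟨Y, z⟩, v⟩` for every `z`. -/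
def IsDerivPairing (W : ℝ≥0 → U → Ω → ℝ) (P : Measure Ω) (T : ℝ≥0) (f : HilbertBasis ι ℝ U)
    (Y : Lp K 2 P) (v : CameronMartin U T) (p : Ω → K) : Prop :=
  ∀ z : K, ∃ (F : Lp ℝ 2 P) (G : Lp (CameronMartin U T) 2 P),
    (F =ᵐ[P] fun ω => ⟪Y ω, z⟫_ℝ) ∧ HasMalliavinDeriv W P T f F G ∧
    ∀ᵐ ω ∂P, ⟪p ω, z⟫_ℝ = ⟪G ω, v⟫_ℝ

/-- `Y = u(T) = S(T) u₀ + ∫₀ᵀ S(T - s) Q^{1/2} dW_s` is the mild solution at time `T` of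
`du = A u dt + Q^{1/2} dW`, `u(0) = u₀`, where `S` is the semigroup generated by `A` and
`R` stands for `Q^{1/2}`. -/
def IsMildSolutionAt (W : ℝ≥0 → U → Ω → ℝ) (P : Measure Ω) (T : ℝ≥0) (f : HilbertBasis ι ℝ U)
    (S : ℝ≥0 → K →L[ℝ] K) (R : U →L[ℝ] K) (u₀ : K) (Y : Lp K 2 P) : Prop :=
  ∃ Z : Lp K 2 P, IsWienerIntegral W P T f (fun s => (S (T - s).toNNReal).comp R) Z ∧
    Y =ᵐ[P] fun ω => S T u₀ + Z ω

end Wiener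

end LinearSPDE

end

/-! The integrand `v_h` is deterministic, and only the vector x = γ†h enters: `v_h(r) = (S(T - r)
R)* x`. For a deterministic v in L²([0,T];U) the Wiener, Itô and Skorokhod integrals are all the
value at v of one linear isometry `isonormal` from L²([0,T];U) to L²(Ω). For each of the three, an
"iff" lemma gives existence and uniqueness together.

The isometry comes from the covariance of Wiener increments, which equals the inner product of the
corresponding step functions. The closed span of these pairs is then the graph of an isometry
(`exists_linearIsometry_of_inner`). Random elementary integrands satisfy the same inner product
identity, so the closure defining the Itô integral is also single-valued
(`isItoIntegral_const_iff`). Expanding v along the basis gives the series form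
(`isWienerIntegral_iff`).

For the Skorokhod integral, existence is Gaussian integration by parts: `indepFun_isonormal` splits
off the direction v, and Stein's identity handles the remaining real variable
(`integral_mul_isonormal`). Uniqueness is the density of 𝔻^{1,2} in L² of the noise
(`eq_zero_of_forall_hasMalliavinDeriv`): a Y orthogonal to every cos W(h) and sin W(h) satisfies E[Y
exp(iW(h))] = 0, and characteristic functions determine measures.

Testing the mild solution against z gives a constant plus W((S(T - ·) R)* z), so its Malliavin
derivative is deterministic. The pairing formula then amounts to moving an adjoint and pulling an
inner product out of a Bochner integral. The L² bound combines ‖R* y‖ ≤ ‖R‖_HS ‖y‖ with the growth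
bound of the semigroup. -/

noncomputable section

namespace LinearSPDE

/-! ### Dominated convergence in L². -/

section SquareIntegrable

variable {α : Type*} {mα : MeasurableSpace α} {μ : Measure α}
  {E : Type*} [NormedAddCommGroup E] [InnerProductSpace ℝ E]

theorem norm_sq_Lp_two (φ : Lp E 2 μ) : ‖φ‖ ^ 2 = ∫ x, ‖φ x‖ ^ 2 ∂μ := by
  rw [← real_inner_self_eq_norm_sq, L2.inner_def]
  simp_rw [real_inner_self_eq_norm_sq]

/-- Dominated convergence for ‖F n - G‖² with majorant (b + ‖G‖)². A general countably generated
filter covers both sequences and finite subsets of a countable basis index. -/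
theorem tendsto_Lp_two_of_dominated {κ : Type*} {l : Filter κ} [l.IsCountablyGenerated]
    {F : κ → Lp E 2 μ} {G : Lp E 2 μ} {b : α → ℝ} (hb : MemLp b 2 μ)
    (hF : ∀ n, ∀ᵐ x ∂μ, ‖F n x‖ ≤ b x)
    (hlim : ∀ᵐ x ∂μ, Tendsto (fun n => F n x) l (𝓝 (G x))) : Tendsto F l (𝓝 G) := by
  have h1 : Tendsto (fun n => ∫ x, ‖(F n - G) x‖ ^ 2 ∂μ) l (𝓝 (∫ _, (0 : ℝ) ∂μ)) := by
    have hae : ∀ n, ∀ᵐ x ∂μ, (F n - G) x = F n x - G x := fun n => Lp.coeFn_sub _ _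
    have key : Tendsto (fun n => ∫ x, ‖F n x - G x‖ ^ 2 ∂μ) l (𝓝 (∫ _, (0 : ℝ) ∂μ)) := by
      refine tendsto_integral_filter_of_dominated_convergence (fun x => (b x + ‖G x‖) ^ 2)
        (Eventually.of_forall fun n => ?_) (Eventually.of_forall fun n => ?_)
        (hb.add (Lp.memLp G).norm).integrable_sq ?_
      · exact (((Lp.aestronglyMeasurable (F n)).sub (Lp.aestronglyMeasurable G)).norm).pow 2
      · filter_upwards [hF n] with x hx
        rw [Real.norm_of_nonneg (by positivity)]
        gcongr
        exact (norm_sub_le _ _).trans (by gcongr)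
      · filter_upwards [hlim] with x hx
        have := ((hx.sub_const (G x)).norm).pow 2
        simpa using this
    refine key.congr fun n => integral_congr_ae ?_
    filter_upwards [hae n] with x hx
    rw [hx]
  rw [tendsto_iff_norm_sub_tendsto_zero]
  have h2 : Tendsto (fun n => Real.sqrt (‖F n - G‖ ^ 2)) l (𝓝 (Real.sqrt 0)) := by
    refine (Real.continuous_sqrt.tendsto 0).comp ?_
    simpa [norm_sq_Lp_two] using h1
  simpa using h2

end SquareIntegrable

/-! ### Density of step functions in L²([0,T];E). -/

section Step

variable {E : Type*} [NormedAddCommGroup E] [InnerProductSpace ℝ E]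

/-- The class of the step function `1_(s, t] u` in `L²([0, T]; E)`. -/
abbrev stepLp (T s t : ℝ≥0) (u : E) : CameronMartin E T :=
  indicatorConstLp 2 (measurableSet_Ioc (a := (s : ℝ)) (b := t)) (measure_ne_top _ _) u

theorem stepLp_coeFn (T s t : ℝ≥0) (u : E) :
    stepLp T s t u =ᵐ[timeMeasure T] (Set.Ioc (s : ℝ) t).indicator fun _ => u :=
  indicatorConstLp_coeFn

theorem exists_mem_Ioc_of_monotone (t : ℕ → ℝ) (N : ℕ) (r : ℝ) (h0 : t 0 < r) (hN : r ≤ t N) :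
    ∃ k < N, r ∈ Set.Ioc (t k) (t (k + 1)) := by
  induction N with
  | zero => exact absurd h0 (not_lt.2 hN)
  | succ n ih =>
    by_cases h : r ≤ t n
    · obtain ⟨k, hk, hk'⟩ := ih h
      exact ⟨k, hk.trans (Nat.lt_succ_self n), hk'⟩
    · exact ⟨n, Nat.lt_succ_self n, not_le.1 h, hN⟩

theorem sum_indicator_Ioc_of_mem {E : Type*} [AddCommMonoid E] {t : ℕ → ℝ} (ht : Monotone t) (u : ℕ → E)
    {N k : ℕ} (hk : k < N)
    {r : ℝ} (hr : r ∈ Set.Ioc (t k) (t (k + 1))) :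
    ∑ j ∈ Finset.range N, (Set.Ioc (t j) (t (j + 1))).indicator (fun _ => u j) r = u k := by
  rw [Finset.sum_eq_single k]
  · rw [Set.indicator_of_mem hr]
  · intro j _ hjk
    refine Set.indicator_of_notMem (fun hj => ?_) _
    rcases lt_or_gt_of_ne hjk with h | h
    · exact absurd (hr.1.trans_le (hj.2.trans (ht h))) (lt_irrefl _)
    · exact absurd (hj.1.trans_le (hr.2.trans (ht h))) (lt_irrefl _)
  · simp [hk]

/-- Bounded continuous functions are dense, and sampling one at the left endpoints of a uniform mesh
converges to it boundedly and almost everywhere. This is the induction principle for all later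
closure arguments. Only consecutive intervals need to be treated, so the increments met there are
independent. -/
theorem mem_of_isClosed_of_mesh {T : ℝ≥0} {C : Set (CameronMartin E T)} (hC : IsClosed C)
    (h : ∀ (N : ℕ) (t : ℕ → ℝ≥0) (u : ℕ → E), Monotone t → t N = T →
      ∑ k ∈ Finset.range N, stepLp T (t k) (t (k + 1)) (u k) ∈ C) (φ : CameronMartin E T) :
    φ ∈ C := by
  have hd := BoundedContinuousFunction.toLp_denseRange (p := 2) E (timeMeasure T) ℝ (by simp)
  refine hd.induction_on φ hC fun g => ?_
  set t : ℕ → ℕ → ℝ≥0 := fun n k => k * T / (n + 1) with ht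
  have htm : ∀ n, Monotone (t n) := fun n a b hab => by
    simp only [ht]; gcongr
  have htN : ∀ n, t n (n + 1) = T := fun n => by
    simp only [ht]; push_cast; field_simp
  have hmem : ∀ n, ∑ k ∈ Finset.range (n + 1), stepLp T (t n k) (t n (k + 1)) (g (t n k)) ∈ C :=
    fun n => h (n + 1) (t n) (fun k => g (t n k)) (htm n) (htN n)
  refine hC.mem_of_tendsto (b := atTop) ?_ (Eventually.of_forall hmem)
  -- The left-open mesh intervals miss the point 0, which is a null set.
  have hpos : ∀ᵐ r ∂(timeMeasure T), 0 < r ∧ r ≤ (T : ℝ) := by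
    have h1 : ∀ᵐ r ∂(timeMeasure T), r ∈ Set.Icc (0 : ℝ) T := ae_restrict_mem measurableSet_Icc
    have h2 : ∀ᵐ r ∂(timeMeasure T), r ≠ 0 :=
      ae_restrict_of_ae (by simp [ae_iff, measure_singleton])
    filter_upwards [h1, h2] with r hr hr0
    exact ⟨lt_of_le_of_ne hr.1 (Ne.symm hr0), hr.2⟩
  have hval : ∀ n, ∀ᵐ r ∂(timeMeasure T), ∃ k : ℕ, |(t n k : ℝ) - r| ≤ T / (n + 1) ∧
      (∑ k ∈ Finset.range (n + 1), stepLp T (t n k) (t n (k + 1)) (g (t n k))) r = g (t n k) := by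
    intro n
    have h1 : ∀ᵐ r ∂(timeMeasure T), ∀ k ∈ Finset.range (n + 1),
        stepLp T (t n k) (t n (k + 1)) (g (t n k)) r =
          (Set.Ioc (t n k : ℝ) (t n (k + 1))).indicator (fun _ => g (t n k)) r :=
      (ae_ball_iff (Finset.countable_toSet _)).2 fun k _ => stepLp_coeFn _ _ _ _
    have h2 := Lp.coeFn_finsetSum (Finset.range (n + 1))
      (fun k => stepLp T (t n k) (t n (k + 1)) (g (t n k)))
    filter_upwards [hpos, h1, h2] with r hr hr1 hr2
    have hm' : Monotone fun k => (t n k : ℝ) := fun a b hab => by exact_mod_cast htm n hab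
    obtain ⟨k, hk, hk'⟩ := exists_mem_Ioc_of_monotone (fun k => (t n k : ℝ)) (n + 1) r
      (by simpa [ht] using hr.1) (by rw [htN n]; exact hr.2)
    refine ⟨k, ?_, ?_⟩
    · have hd : (t n (k + 1) : ℝ) = t n k + T / (n + 1) := by
        simp only [ht]; push_cast; field_simp
      have h1 := hk'.1
      have h2 := hk'.2
      have h3 : (0 : ℝ) ≤ T / (n + 1) := by positivity
      exact abs_le.2 ⟨by linarith, by linarith⟩
    · rw [hr2, Finset.sum_apply, Finset.sum_congr rfl hr1]
      exact sum_indicator_Ioc_of_mem hm' (fun k => g (t n k)) hk hk'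
  refine tendsto_Lp_two_of_dominated (b := fun _ => ‖g‖) (memLp_const _) (fun n => ?_) ?_
  · filter_upwards [hval n] with r hr
    obtain ⟨k, _, hk⟩ := hr
    rw [hk]
    exact g.norm_coe_le_norm _
  · filter_upwards [ae_all_iff.2 hval,
      BoundedContinuousFunction.coeFn_toLp (p := 2) (timeMeasure T) ℝ g] with r hr hg
    rw [hg]
    choose k hk hk' using hr
    have h1 : Tendsto (fun n => (t n (k n) : ℝ)) atTop (𝓝 r) := by
      rw [tendsto_iff_norm_sub_tendsto_zero]
      refine squeeze_zero (fun _ => norm_nonneg _) hk ?_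
      have := (tendsto_one_div_add_atTop_nhds_zero_nat (𝕜 := ℝ)).const_mul (T : ℝ)
      simpa [div_eq_mul_inv] using this
    refine ((g.continuous.tendsto r).comp h1).congr fun n => ?_
    exact (hk' n).symm

end Step

/-! ### Expansion of L² functions along an orthonormal basis of the target. -/

section Coordinates

variable {α : Type*} {mα : MeasurableSpace α} {μ : Measure α}
  {E : Type*} [NormedAddCommGroup E] [InnerProductSpace ℝ E] {ι : Type*}

/-- The projection of `E` onto the line spanned by the basis vector `f j`. -/
def coordProj (f : HilbertBasis ι ℝ E) (j : ι) : E →L[ℝ] E :=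
  (innerSL ℝ (f j)).smulRight (f j)

theorem coordProj_apply (f : HilbertBasis ι ℝ E) (j : ι) (u : E) :
    coordProj f j u = ⟪f j, u⟫_ℝ • f j := by
  simp [coordProj]

theorem norm_sum_coordProj_le (f : HilbertBasis ι ℝ E) (s : Finset ι) (u : E) :
    ‖∑ j ∈ s, coordProj f j u‖ ≤ ‖u‖ := by
  have h1 : ‖∑ j ∈ s, coordProj f j u‖ ^ 2 = ∑ j ∈ s, ‖⟪f j, u⟫_ℝ‖ ^ 2 := by
    simp_rw [coordProj_apply]
    rw [← real_inner_self_eq_norm_sq, f.orthonormal.inner_sum]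
    simp [sq]
  have h2 := f.orthonormal.sum_inner_products_le u (s := s)
  exact le_of_sq_le_sq (by rw [h1]; exact h2) (norm_nonneg _)

/-- The expansion converges pointwise, and Bessel's inequality makes ‖φ‖ a majorant of every partial
sum. -/
theorem hasSum_coordProj_compLp [Countable ι] (f : HilbertBasis ι ℝ E) (φ : Lp E 2 μ) :
    HasSum (fun j => (coordProj f j).compLp φ) φ := by
  have hval : ∀ s : Finset ι, ∀ᵐ x ∂μ,
      (∑ j ∈ s, (coordProj f j).compLp φ) x = ∑ j ∈ s, coordProj f j (φ x) := by
    intro s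
    have h1 : ∀ᵐ x ∂μ, ∀ j : ι, (coordProj f j).compLp φ x = coordProj f j (φ x) :=
      ae_all_iff.2 fun j => ContinuousLinearMap.coeFn_compLp _ _
    filter_upwards [h1, Lp.coeFn_finsetSum s fun j => (coordProj f j).compLp φ] with x hx hx'
    rw [hx', Finset.sum_apply]
    exact Finset.sum_congr rfl fun j _ => hx j
  refine tendsto_Lp_two_of_dominated (Lp.memLp φ).norm (fun s => ?_) ?_
  · filter_upwards [hval s] with x hx
    rw [hx]
    exact norm_sum_coordProj_le f s _
  · filter_upwards [ae_all_iff.2 hval] with x hx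
    have h3 := f.hasSum_repr (φ x)
    simp_rw [f.repr_apply_apply] at h3
    refine Tendsto.congr (fun s => ?_) h3
    rw [hx s]
    simp [coordProj_apply]

end Coordinates

/-! ### Laws and covariances of Wiener increments. -/

section Increments

variable {Ω : Type*} {mΩ : MeasurableSpace Ω} {P : Measure Ω} {𝓕 : Filtration ℝ≥0 mΩ}
  {U : Type*} [NormedAddCommGroup U] [InnerProductSpace ℝ U] {W : ℝ≥0 → U → Ω → ℝ}

/-- The increment `⟨W_t - W_s, u⟩`. -/
def increment (W : ℝ≥0 → U → Ω → ℝ) (s t : ℝ≥0) (u : U) (ω : Ω) : ℝ := W t u ω - W s u ω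

namespace IsCylindricalWiener

theorem measurable (hW : IsCylindricalWiener W 𝓕 P) (t : ℝ≥0) (u : U) : Measurable (W t u) :=
  (hW.adapted t u).mono (𝓕.le t) le_rfl

theorem measurable_increment_filtration (hW : IsCylindricalWiener W 𝓕 P) {s t r : ℝ≥0}
    (hst : s ≤ t) (htr : t ≤ r) (u : U) : Measurable[𝓕 r] (increment W s t u) :=
  (((hW.adapted t u).mono (𝓕.mono htr) le_rfl).sub
    ((hW.adapted s u).mono (𝓕.mono (hst.trans htr)) le_rfl))

theorem measurable_increment (hW : IsCylindricalWiener W 𝓕 P) (s t : ℝ≥0) (u : U) :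
    Measurable (increment W s t u) :=
  (hW.measurable t u).sub (hW.measurable s u)

theorem add_ae (hW : IsCylindricalWiener W 𝓕 P) (t : ℝ≥0) (u v : U) :
    W t (u + v) =ᵐ[P] fun ω => W t u ω + W t v ω := by
  simpa using hW.linear t 1 1 u v

theorem smul_ae (hW : IsCylindricalWiener W 𝓕 P) (t : ℝ≥0) (a : ℝ) (u : U) :
    W t (a • u) =ᵐ[P] fun ω => a * W t u ω := by
  simpa using hW.linear t a 0 u 0

theorem increment_add_ae (hW : IsCylindricalWiener W 𝓕 P) (s t : ℝ≥0) (u v : U) :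
    increment W s t (u + v) =ᵐ[P] fun ω => increment W s t u ω + increment W s t v ω := by
  filter_upwards [hW.add_ae t u v, hW.add_ae s u v] with ω h1 h2
  simp only [increment, h1, h2]; ring

theorem increment_smul_ae (hW : IsCylindricalWiener W 𝓕 P) (s t : ℝ≥0) (a : ℝ) (u : U) :
    increment W s t (a • u) =ᵐ[P] fun ω => a * increment W s t u ω := by
  filter_upwards [hW.smul_ae t a u, hW.smul_ae s a u] with ω h1 h2
  simp only [increment, h1, h2]; ring

/-- The Brownian property is given for unit vectors only, so u is normalised and almost sure
homogeneity restores the factor ‖u‖. For u = 0 the law is a Dirac mass, the Gaussian of variance 0.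
-/
theorem hasLaw_increment [IsProbabilityMeasure P] (hW : IsCylindricalWiener W 𝓕 P) {s t : ℝ≥0}
    (hst : s ≤ t) (u : U) :
    HasLaw (increment W s t u) (gaussianReal 0 (‖u‖₊ ^ 2 * (t - s))) P := by
  by_cases hu : u = 0
  · subst hu
    have h := hW.increment_smul_ae s t 0 0
    have h' : increment W s t (0 : U) =ᵐ[P] fun _ => (0 : ℝ) := by simpa using h
    have : HasLaw (increment W s t (0 : U)) (Measure.dirac (0 : ℝ)) P := hasLaw_dirac_of_ae_eq h'
    simpa using this
  · have hu' : ‖u‖ ≠ 0 := norm_ne_zero_iff.2 hu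
    have h1 : ‖(‖u‖⁻¹ • u)‖ = 1 := by rw [norm_smul]; simp [hu']
    have h2 := (hW.brownian _ h1).hasLaw_sub t s
    have h3 := gaussianReal_const_mul h2 ‖u‖
    have h4 := hW.increment_smul_ae s t ‖u‖ (‖u‖⁻¹ • u)
    rw [smul_inv_smul₀ hu'] at h4
    have h5 := h3.congr h4
    convert h5 using 2
    · simp
    · congr 1
      apply NNReal.eq
      rw [NNReal.coe_sub hst, coe_nndist, Real.dist_eq, abs_of_nonneg]
      · rfl
      · exact sub_nonneg.2 (by exact_mod_cast hst)

theorem indepFun_increment (hW : IsCylindricalWiener W 𝓕 P) {s t : ℝ≥0} (hst : s ≤ t) (u : U)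
    {E : Type*} [MeasurableSpace E] {Z : Ω → E} (hZ : Measurable[𝓕 s] Z) :
    IndepFun Z (increment W s t u) P := by
  rw [IndepFun_iff_Indep]
  exact (indep_of_indep_of_le_right (hW.indep s t hst u) hZ.comap_le).symm

variable [IsProbabilityMeasure P]

theorem memLp_increment (hW : IsCylindricalWiener W 𝓕 P) {s t : ℝ≥0} (hst : s ≤ t) (u : U) :
    MemLp (increment W s t u) 2 P :=
  (hW.hasLaw_increment hst u).hasGaussianLaw.memLp_two

theorem integral_increment (hW : IsCylindricalWiener W 𝓕 P) {s t : ℝ≥0} (hst : s ≤ t) (u : U) :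
    ∫ ω, increment W s t u ω ∂P = 0 := by
  rw [(hW.hasLaw_increment hst u).integral_eq, integral_id_gaussianReal]

theorem integral_increment_sq (hW : IsCylindricalWiener W 𝓕 P) {s t : ℝ≥0} (hst : s ≤ t) (u : U) :
    ∫ ω, increment W s t u ω ^ 2 ∂P = ‖u‖ ^ 2 * (t - s) := by
  have h := (hW.hasLaw_increment hst u).variance_eq
  rw [variance_id_gaussianReal, variance_of_integral_eq_zero
    (hW.measurable_increment s t u).aemeasurable (hW.integral_increment hst u)] at h
  rw [h]
  push_cast
  rw [NNReal.coe_sub hst]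

theorem integral_mul_increment (hW : IsCylindricalWiener W 𝓕 P) {s t : ℝ≥0} (hst : s ≤ t) (u : U)
    {Z : Ω → ℝ} (hZ : Measurable[𝓕 s] Z) : ∫ ω, Z ω * increment W s t u ω ∂P = 0 := by
  rw [(hW.indepFun_increment hst u hZ).integral_fun_mul_eq_mul_integral
    (hZ.mono (𝓕.le s) le_rfl).aestronglyMeasurable
    (hW.measurable_increment s t u).aestronglyMeasurable, hW.integral_increment hst, mul_zero]

theorem integral_mul_increment_sq (hW : IsCylindricalWiener W 𝓕 P) {s t : ℝ≥0} (hst : s ≤ t)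
    (u : U) {Z : Ω → ℝ} (hZ : Measurable[𝓕 s] Z) :
    ∫ ω, Z ω * increment W s t u ω ^ 2 ∂P = (∫ ω, Z ω ∂P) * (‖u‖ ^ 2 * (t - s)) := by
  have h := (hW.indepFun_increment hst u hZ).comp measurable_id (measurable_id.pow_const 2)
  have h' := h.integral_fun_mul_eq_mul_integral
    (hZ.mono (𝓕.le s) le_rfl).aestronglyMeasurable
    ((hW.measurable_increment s t u).pow_const 2).aestronglyMeasurable
  simp only [Function.comp_def, id] at h'
  rw [h', hW.integral_increment_sq hst]

theorem integrable_mul_increment_mul (hW : IsCylindricalWiener W 𝓕 P) {s t s' t' : ℝ≥0}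
    (hst : s ≤ t) (hst' : s' ≤ t') (u u' : U) {ζ : Ω → ℝ} (hζ : Measurable ζ) {C : ℝ}
    (hC : ∀ ω, |ζ ω| ≤ C) :
    Integrable (fun ω => ζ ω * (increment W s t u ω * increment W s' t' u' ω)) P :=
  ((hW.memLp_increment hst u).integrable_mul (hW.memLp_increment hst' u')).bdd_mul
    hζ.aestronglyMeasurable (Eventually.of_forall hC)

/-- Polarisation: expand the square of the increment in direction u + u'. -/
theorem integral_mul_increment_mul_self (hW : IsCylindricalWiener W 𝓕 P) {s t : ℝ≥0} (hst : s ≤ t)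
    (u u' : U) {ζ : Ω → ℝ} (hζ : Measurable[𝓕 s] ζ) {C : ℝ} (hC : ∀ ω, |ζ ω| ≤ C) :
    ∫ ω, ζ ω * (increment W s t u ω * increment W s t u' ω) ∂P =
      (∫ ω, ζ ω ∂P) * (⟪u, u'⟫_ℝ * (t - s)) := by
  have hζ' := hζ.mono (𝓕.le s) le_rfl
  have hi := fun v w : U => hW.integrable_mul_increment_mul hst hst v w hζ' hC
  have h1 := hW.integral_mul_increment_sq hst (u + u') hζ
  have h2 : ∫ ω, ζ ω * increment W s t (u + u') ω ^ 2 ∂P =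
      ∫ ω, (ζ ω * (increment W s t u ω * increment W s t u ω) +
        2 * (ζ ω * (increment W s t u ω * increment W s t u' ω))) +
        ζ ω * (increment W s t u' ω * increment W s t u' ω) ∂P := by
    refine integral_congr_ae ?_
    filter_upwards [hW.increment_add_ae s t u u'] with ω h
    rw [h]; ring
  have hi3 : Integrable (fun ω => ζ ω * (increment W s t u ω * increment W s t u ω) +
      2 * (ζ ω * (increment W s t u ω * increment W s t u' ω))) P :=
    (hi u u).add ((hi u u').const_mul 2)
  rw [h2, integral_add hi3 (hi u' u'),
    integral_add (hi u u) ((hi u u').const_mul 2), integral_const_mul] at h1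
  have h3 := hW.integral_mul_increment_sq hst u hζ
  have h4 := hW.integral_mul_increment_sq hst u' hζ
  simp only [sq] at h3 h4
  rw [h3, h4, norm_add_sq_real] at h1
  linear_combination h1 / 2

/-- The Itô isometry for two elementary integrands, the second of which starts later. -/
theorem integral_mul_increment_mul_of_le (hW : IsCylindricalWiener W 𝓕 P) {s t s' t' : ℝ≥0}
    (hst : s ≤ t) (hst' : s' ≤ t') (hss' : s ≤ s') (u u' : U) {ζ : Ω → ℝ}
    (hζ : Measurable[𝓕 s'] ζ) {C : ℝ} (hC : ∀ ω, |ζ ω| ≤ C) :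
    ∫ ω, ζ ω * (increment W s t u ω * increment W s' t' u' ω) ∂P =
      (∫ ω, ζ ω ∂P) * (⟪u, u'⟫_ℝ * volume.real (Set.Ioc (s : ℝ) t ∩ Set.Ioc (s' : ℝ) t')) := by
  have hζ' := hζ.mono (𝓕.le s') le_rfl
  -- The increment over (c, d] is centred and independent of `𝓕 c`, with respect to which ζ and the
  -- earlier increment are both measurable.
  have hdisj : ∀ {a b c d : ℝ≥0}, a ≤ b → b ≤ c → c ≤ d → s' ≤ c → ∀ v w : U,
      ∫ ω, ζ ω * (increment W a b v ω * increment W c d w ω) ∂P = 0 := by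
    intro a b c d hab hbc hcd hsc v w
    simp_rw [← mul_assoc]
    exact hW.integral_mul_increment hcd w
      ((hζ.mono (𝓕.mono hsc) le_rfl).mul (hW.measurable_increment_filtration hab hbc v))
  have hsplit : ∀ (a b c : ℝ≥0) (v : U) (ω : Ω),
      increment W a c v ω = increment W a b v ω + increment W b c v ω := by
    intro a b c v ω; simp only [increment]; ring
  have hswap : ∀ (a b c d : ℝ≥0) (v w : U),
      ∫ ω, ζ ω * (increment W a b v ω * increment W c d w ω) ∂P =
        ∫ ω, ζ ω * (increment W c d w ω * increment W a b v ω) ∂P := by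
    intro a b c d v w
    simp_rw [mul_comm (increment W a b v _)]
  rcases le_total t s' with hts | hts
  · rw [hdisj hst hts hst' le_rfl]
    have : Set.Ioc (s : ℝ) t ∩ Set.Ioc (s' : ℝ) t' = ∅ := by
      rw [Set.Ioc_inter_Ioc, Set.Ioc_eq_empty]
      have : (t : ℝ) ≤ s' := by exact_mod_cast hts
      exact not_lt.2 (inf_le_left.trans (this.trans le_sup_right))
    simp [this]
  have hvol : volume.real (Set.Ioc (s : ℝ) t ∩ Set.Ioc (s' : ℝ) t') = min t t' - s' := by
    rw [Set.Ioc_inter_Ioc, sup_eq_right.2 (by exact_mod_cast hss' : (s : ℝ) ≤ s'),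
      Real.volume_real_Ioc_of_le]
    · push_cast; rfl
    · exact le_inf (by exact_mod_cast hts) (by exact_mod_cast hst')
  -- The piece of (s, t] before s' contributes nothing. Below, the longer of the two remaining
  -- intervals is cut at the end of the shorter one, which leaves two increments over the same
  -- interval.
  have hstart : ∫ ω, ζ ω * (increment W s t u ω * increment W s' t' u' ω) ∂P =
      ∫ ω, ζ ω * (increment W s' t u ω * increment W s' t' u' ω) ∂P := by
    have h0 := hdisj hss' le_rfl hst' le_rfl u u'
    rw [← add_zero (∫ ω, ζ ω * (increment W s' t u ω * increment W s' t' u' ω) ∂P), ← h0,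
      ← integral_add (hW.integrable_mul_increment_mul hts hst' u u' hζ' hC)
        (hW.integrable_mul_increment_mul hss' hst' u u' hζ' hC)]
    refine integral_congr_ae (Eventually.of_forall fun ω => ?_)
    simp only [hsplit s s' t u ω]; ring
  rw [hstart, hvol]
  rcases le_total t t' with htt | htt
  · have h0 := hdisj hts le_rfl htt hts u u'
    rw [min_eq_left (by exact_mod_cast htt), ← hW.integral_mul_increment_mul_self hts u u' hζ hC,
      ← add_zero (∫ ω, ζ ω * (increment W s' t u ω * increment W s' t u' ω) ∂P), ← h0,
      ← integral_add (hW.integrable_mul_increment_mul hts hts u u' hζ' hC)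
        (hW.integrable_mul_increment_mul hts htt u u' hζ' hC)]
    refine integral_congr_ae (Eventually.of_forall fun ω => ?_)
    simp only [hsplit s' t t' u' ω]; ring
  · have h0 := hdisj hst' le_rfl htt hst' u' u
    rw [hswap] at h0
    rw [min_eq_right (by exact_mod_cast htt), ← hW.integral_mul_increment_mul_self hst' u u' hζ hC,
      ← add_zero (∫ ω, ζ ω * (increment W s' t' u ω * increment W s' t' u' ω) ∂P), ← h0,
      ← integral_add (hW.integrable_mul_increment_mul hst' hst' u u' hζ' hC)
        (hW.integrable_mul_increment_mul htt hst' u u' hζ' hC)]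
    refine integral_congr_ae (Eventually.of_forall fun ω => ?_)
    simp only [hsplit s' t' t u ω]; ring

theorem integral_mul_increment_mul (hW : IsCylindricalWiener W 𝓕 P) {s t s' t' : ℝ≥0}
    (hst : s ≤ t) (hst' : s' ≤ t') (u u' : U) {ξ η : Ω → ℝ}
    (hξ : Measurable[𝓕 s] ξ) (hη : Measurable[𝓕 s'] η) {C D : ℝ} (hC : ∀ ω, |ξ ω| ≤ C)
    (hD : ∀ ω, |η ω| ≤ D) :
    ∫ ω, (ξ ω * increment W s t u ω) * (η ω * increment W s' t' u' ω) ∂P =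
      (∫ ω, ξ ω * η ω ∂P) *
        (⟪u, u'⟫_ℝ * volume.real (Set.Ioc (s : ℝ) t ∩ Set.Ioc (s' : ℝ) t')) := by
  have hb : ∀ ω, |ξ ω * η ω| ≤ C * D := fun ω => by
    rw [abs_mul]
    exact mul_le_mul (hC ω) (hD ω) (abs_nonneg _) ((abs_nonneg _).trans (hC ω))
  rcases le_total s s' with h | h
  · have := hW.integral_mul_increment_mul_of_le hst hst' h u u'
      ((hξ.mono (𝓕.mono h) le_rfl).mul hη) hb
    simp only [Pi.mul_apply] at this
    rw [← this]
    refine integral_congr_ae (Eventually.of_forall fun ω => ?_)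
    simp only; ring
  · rw [real_inner_comm, Set.inter_comm]
    have := hW.integral_mul_increment_mul_of_le hst' hst h u' u
      (hξ.mul (hη.mono (𝓕.mono h) le_rfl)) hb
    simp only [Pi.mul_apply] at this
    rw [← this]
    refine integral_congr_ae (Eventually.of_forall fun ω => ?_)
    simp only; ring

end IsCylindricalWiener

end Increments

/-! ### Isometries obtained as closures of graphs. -/

section Isometry

variable {E F : Type*} [NormedAddCommGroup E] [InnerProductSpace ℝ E]
  [NormedAddCommGroup F] [InnerProductSpace ℝ F]

theorem inner_eq_of_mem_span {G : Set (E × F)}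
    (hG : ∀ p ∈ G, ∀ q ∈ G, ⟪p.1, q.1⟫_ℝ = ⟪p.2, q.2⟫_ℝ) {p q : E × F}
    (hp : p ∈ Submodule.span ℝ G) (hq : q ∈ Submodule.span ℝ G) :
    ⟪p.1, q.1⟫_ℝ = ⟪p.2, q.2⟫_ℝ := by
  induction hp, hq using Submodule.span_induction₂ with
  | mem_mem x y hx hy => exact hG x hx y hy
  | zero_left y hy => simp
  | zero_right x hx => simp
  | add_left x y z _ _ _ h1 h2 => simp [inner_add_left, h1, h2]
  | add_right x y z _ _ _ h1 h2 => simp [inner_add_right, h1, h2]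
  | smul_left r x y _ _ h => simp [inner_smul_left, h]
  | smul_right r x y _ _ h => simp [inner_smul_right, h]

/-- Bilinearity carries the identity from G to its span, and equality of norms is a closed
condition. A closed span of this kind is therefore single-valued, which is also what makes the Itô
integral unique. -/
theorem norm_eq_of_mem_closure_span {G : Set (E × F)}
    (hG : ∀ p ∈ G, ∀ q ∈ G, ⟪p.1, q.1⟫_ℝ = ⟪p.2, q.2⟫_ℝ) {p : E × F}
    (hp : p ∈ (Submodule.span ℝ G).topologicalClosure) : ‖p.1‖ = ‖p.2‖ := by
  have hc : IsClosed {p : E × F | ‖p.1‖ = ‖p.2‖} :=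
    isClosed_eq continuous_fst.norm continuous_snd.norm
  refine closure_minimal (fun q hq => ?_) hc hp
  have h := inner_eq_of_mem_span hG hq hq
  rw [real_inner_self_eq_norm_sq, real_inner_self_eq_norm_sq] at h
  exact (sq_eq_sq₀ (norm_nonneg _) (norm_nonneg _)).1 h

/-- If first components converge, equality of norms makes the second components Cauchy. -/
theorem exists_mem_of_dense_fst [CompleteSpace F] {S : Submodule ℝ (E × F)}
    (hS : IsClosed (S : Set (E × F))) (hn : ∀ p ∈ S, ‖p.1‖ = ‖p.2‖)
    (hd : Dense (Prod.fst '' (S : Set (E × F)))) (x : E) : ∃ y, (x, y) ∈ S := by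
  obtain ⟨a, ha, hax⟩ := mem_closure_iff_seq_limit.1 (hd x)
  choose p hp hpa using ha
  have hcau : CauchySeq fun n => (p n).2 := by
    have hca := hax.cauchySeq
    rw [Metric.cauchySeq_iff] at hca ⊢
    intro ε hε
    obtain ⟨N, hN⟩ := hca ε hε
    refine ⟨N, fun m hm n hn' => ?_⟩
    have := hN m hm n hn'
    rw [← hpa, ← hpa, dist_eq_norm, ← Prod.fst_sub, hn _ (S.sub_mem (hp m) (hp n))] at this
    rwa [dist_eq_norm, ← Prod.snd_sub]
  obtain ⟨y, hy⟩ := cauchySeq_tendsto_of_complete hcau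
  refine ⟨y, hS.mem_of_tendsto (hax.prodMk_nhds hy) (Eventually.of_forall fun n => ?_)⟩
  rw [← hpa n]
  exact hp n

/-- The closed span of G is the graph sought: two values over the same point differ by a vector of
norm ‖0‖, and density with completeness gives a value everywhere. G need not be known to be
single-valued beforehand. -/
theorem exists_linearIsometry_of_inner [CompleteSpace F] {G : Set (E × F)}
    (hG : ∀ p ∈ G, ∀ q ∈ G, ⟪p.1, q.1⟫_ℝ = ⟪p.2, q.2⟫_ℝ)
    (hd : Dense (Submodule.span ℝ (Prod.fst '' G) : Set E)) :
    ∃ I : E →ₗᵢ[ℝ] F, ∀ p ∈ G, I p.1 = p.2 := by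
  set S := (Submodule.span ℝ G).topologicalClosure with hSdef
  have hn : ∀ p ∈ S, ‖p.1‖ = ‖p.2‖ := fun p hp => norm_eq_of_mem_closure_span hG hp
  have hd' : Dense (Prod.fst '' (S : Set (E × F))) := by
    refine hd.mono ?_
    have h1 : Submodule.span ℝ (Prod.fst '' G) ≤ S.map (LinearMap.fst ℝ E F) := by
      rw [Submodule.span_le]
      rintro _ ⟨p, hp, rfl⟩
      exact ⟨p, Submodule.le_topologicalClosure _ (Submodule.subset_span hp), rfl⟩
    intro x hx
    obtain ⟨p, hp, rfl⟩ := h1 hx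
    exact ⟨p, hp, rfl⟩
  have huniq : ∀ {x y z}, (x, y) ∈ S → (x, z) ∈ S → y = z := by
    intro x y z hy hz
    have := hn _ (S.sub_mem hy hz)
    simp only [Prod.mk_sub_mk, sub_self, norm_zero] at this
    exact sub_eq_zero.1 (norm_eq_zero.1 this.symm)
  choose I hI using exists_mem_of_dense_fst (S := S) isClosed_closure hn hd'
  refine ⟨⟨⟨⟨I, fun x y => ?_⟩, fun c x => ?_⟩, fun x => ?_⟩, fun p hp => ?_⟩
  · exact huniq (hI (x + y)) (S.add_mem (hI x) (hI y))
  · exact huniq (hI (c • x)) (S.smul_mem c (hI x))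
  · exact (hn _ (hI x)).symm
  · exact huniq (hI p.1) (Submodule.le_topologicalClosure _ (Submodule.subset_span hp))

end Isometry

/-! ### The Itô isometry and the integral of deterministic integrands. -/

section Ito

variable {Ω : Type*} {mΩ : MeasurableSpace Ω} {P : Measure Ω} {𝓕 : Filtration ℝ≥0 mΩ}
  {U : Type*} [NormedAddCommGroup U] [InnerProductSpace ℝ U] {W : ℝ≥0 → U → Ω → ℝ}

theorem inner_const_Lp_two [IsProbabilityMeasure P] {E : Type*} [NormedAddCommGroup E]
    [InnerProductSpace ℝ E] [CompleteSpace E] (a b : E) :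
    ⟪Lp.const 2 P a, Lp.const 2 P b⟫_ℝ = ⟪a, b⟫_ℝ := by
  rw [L2.inner_def]
  have : ∀ᵐ ω ∂P, ⟪Lp.const 2 P a ω, Lp.const 2 P b ω⟫_ℝ = ⟪a, b⟫_ℝ := by
    filter_upwards [Lp.coeFn_const (p := 2) (μ := P) (c := a),
      Lp.coeFn_const (p := 2) (μ := P) (c := b)] with ω h1 h2
    rw [h1, h2]; rfl
  rw [integral_congr_ae this]
  simp

theorem inner_stepLp [CompleteSpace U] {T s t s' t' : ℝ≥0} (ht : t ≤ T) (u u' : U) :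
    ⟪stepLp T s t u, stepLp T s' t' u'⟫_ℝ =
      ⟪u, u'⟫_ℝ * volume.real (Set.Ioc (s : ℝ) t ∩ Set.Ioc (s' : ℝ) t') := by
  rw [L2.inner_indicatorConstLp_indicatorConstLp, smul_eq_mul, mul_comm, measureReal_def,
    measureReal_def, Measure.restrict_apply (measurableSet_Ioc.inter measurableSet_Ioc),
    Set.inter_eq_self_of_subset_left]
  intro r hr
  exact ⟨s.2.trans hr.1.1.le, hr.1.2.trans (by exact_mod_cast ht)⟩

/-- The pairs `(v, ∫₀ᵀ ⟨v, dW⟩)` for the elementary integrands `v = ξ 1_(s, t] u`. -/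
def itoTerms (W : ℝ≥0 → U → Ω → ℝ) (𝓕 : Filtration ℝ≥0 mΩ) (P : Measure Ω) (T : ℝ≥0) :
    Set (Lp (CameronMartin U T) 2 P × Lp ℝ 2 P) :=
  {p | ∃ (s t : ℝ≥0) (u : U) (ξ : Ω → ℝ), s ≤ t ∧ t ≤ T ∧ Measurable[𝓕 s] ξ ∧
    (∃ C : ℝ, ∀ ω, |ξ ω| ≤ C) ∧ (p.1 =ᵐ[P] fun ω => ξ ω • stepLp T s t u) ∧
    (p.2 =ᵐ[P] fun ω => ξ ω * increment W s t u ω)}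

variable [IsProbabilityMeasure P]

/-- Both sides equal E[ξη]⟨u, u'⟩ times the length of the overlap of the two intervals. This is the
Itô isometry in the form needed by `norm_eq_of_mem_closure_span`. -/
theorem inner_itoTerms [CompleteSpace U] (hW : IsCylindricalWiener W 𝓕 P) (T : ℝ≥0) :
    ∀ p ∈ itoTerms W 𝓕 P T, ∀ q ∈ itoTerms W 𝓕 P T, ⟪p.1, q.1⟫_ℝ = ⟪p.2, q.2⟫_ℝ := by
  rintro p ⟨s, t, u, ξ, hst, htT, hξ, ⟨C, hC⟩, hp1, hp2⟩ q
    ⟨s', t', u', η, hst', htT', hη, ⟨D, hD⟩, hq1, hq2⟩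
  have h1 : ⟪p.1, q.1⟫_ℝ = (∫ ω, ξ ω * η ω ∂P) *
      (⟪u, u'⟫_ℝ * volume.real (Set.Ioc (s : ℝ) t ∩ Set.Ioc (s' : ℝ) t')) := by
    rw [L2.inner_def, ← integral_mul_const]
    refine integral_congr_ae ?_
    filter_upwards [hp1, hq1] with ω h1 h2
    rw [h1, h2, real_inner_smul_left, real_inner_smul_right, inner_stepLp htT]
    ring
  rw [h1, ← hW.integral_mul_increment_mul hst hst' u u' hξ hη hC hD, L2.inner_def]
  refine integral_congr_ae ?_
  filter_upwards [hp2, hq2] with ω h1 h2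
  rw [h1, h2, real_inner_eq_re_inner]
  simp [mul_comm]

theorem exists_mem_itoTerms (hW : IsCylindricalWiener W 𝓕 P) {T s t : ℝ≥0} (hst : s ≤ t)
    (htT : t ≤ T) (u : U) {ξ : Ω → ℝ} (hξ : Measurable[𝓕 s] ξ) (hC : ∃ C : ℝ, ∀ ω, |ξ ω| ≤ C) :
    ∃ p ∈ itoTerms W 𝓕 P T, (p.1 =ᵐ[P] fun ω => ξ ω • stepLp T s t u) ∧
      (p.2 =ᵐ[P] fun ω => ξ ω * increment W s t u ω) := by
  have hξ' := hξ.mono (𝓕.le s) le_rfl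
  have h1 : MemLp (fun ω => ξ ω • stepLp T s t u) 2 P := by
    obtain ⟨C, hC⟩ := hC
    refine MemLp.of_bound (hξ'.aestronglyMeasurable.smul_const _) (C * ‖stepLp T s t u‖)
      (Eventually.of_forall fun ω => ?_)
    rw [norm_smul]
    gcongr
    exact hC ω
  have h2 : MemLp (fun ω => ξ ω * increment W s t u ω) 2 P := by
    obtain ⟨C, hC⟩ := hC
    refine MemLp.of_le_mul (c := C) (hW.memLp_increment hst u)
      (hξ'.mul (hW.measurable_increment s t u)).aestronglyMeasurable
      (Eventually.of_forall fun ω => ?_)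
    rw [norm_mul]
    gcongr
    exact hC ω
  exact ⟨(h1.toLp _, h2.toLp _), ⟨s, t, u, ξ, hst, htT, hξ, hC, h1.coeFn_toLp, h2.coeFn_toLp⟩,
    h1.coeFn_toLp, h2.coeFn_toLp⟩

/-- Places the Itô graph inside a subspace with isometric closure, where differences of pairs can be
taken. -/
theorem elementaryItoGraph_subset_span (hW : IsCylindricalWiener W 𝓕 P) (T : ℝ≥0) :
    elementaryItoGraph W 𝓕 P T ⊆ Submodule.span ℝ (itoTerms W 𝓕 P T) := by
  rintro p ⟨n, s, t, u, ξ, hst, hξ, hp1, hp2⟩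
  choose q hq hq1 hq2 using fun i =>
    exists_mem_itoTerms hW (hst i).1 (hst i).2 (u i) (hξ i).1 (hξ i).2
  have hpq : p = ∑ i, q i := by
    refine Prod.ext (Lp.ext ?_) (Lp.ext ?_)
    · rw [Prod.fst_sum]
      filter_upwards [hp1, Lp.coeFn_finsetSum Finset.univ (fun i => (q i).1),
        ae_all_iff.2 hq1] with ω h1 h2 h3
      rw [h2, Finset.sum_apply]
      refine Lp.ext ?_
      have h4 : ∀ᵐ r ∂(timeMeasure T), ∀ i, (ξ i ω • stepLp T (s i) (t i) (u i)) r =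
          (Set.Ioc (s i : ℝ) (t i)).indicator (fun _ => ξ i ω • u i) r := by
        refine ae_all_iff.2 fun i => ?_
        filter_upwards [Lp.coeFn_smul (ξ i ω) (stepLp T (s i) (t i) (u i)),
          stepLp_coeFn T (s i) (t i) (u i)] with r h5 h6
        rw [h5, Pi.smul_apply, h6]
        by_cases hr : r ∈ Set.Ioc (s i : ℝ) (t i) <;> simp [hr]
      filter_upwards [h1, h4, Lp.coeFn_finsetSum Finset.univ (fun i => (q i).1 ω)] with r h5 h6 h7
      rw [h5, h7, Finset.sum_apply]
      refine Finset.sum_congr rfl fun i _ => ?_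
      rw [h3 i, h6 i]
    · rw [Prod.snd_sum]
      filter_upwards [hp2, Lp.coeFn_finsetSum Finset.univ (fun i => (q i).2),
        ae_all_iff.2 hq2] with ω h1 h2 h3
      rw [h2, h1, Finset.sum_apply]
      exact Finset.sum_congr rfl fun i _ => (h3 i).symm
  rw [hpq]
  exact Submodule.sum_mem _ fun i _ => Submodule.subset_span (hq i)

theorem const_stepLp_mem_itoTerms (hW : IsCylindricalWiener W 𝓕 P) {T s t : ℝ≥0} (hst : s ≤ t)
    (htT : t ≤ T) (u : U) :
    (Lp.const 2 P (stepLp T s t u), (hW.memLp_increment hst u).toLp _) ∈ itoTerms W 𝓕 P T := by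
  refine ⟨s, t, u, fun _ => 1, hst, htT, measurable_const, ⟨1, fun _ => by simp⟩, ?_, ?_⟩
  · filter_upwards [Lp.coeFn_const (p := 2) (μ := P) (c := stepLp T s t u)] with ω h
    rw [h]; simp
  · filter_upwards [(hW.memLp_increment hst u).coeFn_toLp] with ω h
    rw [h]; simp

theorem dense_span_stepLp (T : ℝ≥0) : Dense (Submodule.span ℝ
    {φ : CameronMartin U T | ∃ s t u, s ≤ t ∧ t ≤ T ∧ φ = stepLp T s t u} :
      Set (CameronMartin U T)) := by
  intro φ
  refine mem_of_isClosed_of_mesh isClosed_closure (fun N t u ht hN => subset_closure ?_) φ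
  refine Submodule.sum_mem _ fun k hk => Submodule.subset_span
    ⟨t k, t (k + 1), u k, ht (Nat.le_succ k), ?_, rfl⟩
  rw [← hN]
  exact ht (Finset.mem_range.1 hk)

/-- A deterministic step function is an Itô term with ξ = 1, and constants embed isometrically into
L² of a probability space, so the Itô isometry restricts to deterministic functions. -/
theorem exists_isonormal [CompleteSpace U] (hW : IsCylindricalWiener W 𝓕 P) (T : ℝ≥0) :
    ∃ I : CameronMartin U T →ₗᵢ[ℝ] Lp ℝ 2 P, ∀ (s t : ℝ≥0) (u : U) (hst : s ≤ t), t ≤ T →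
      I (stepLp T s t u) = (hW.memLp_increment hst u).toLp _ := by
  set G : Set (CameronMartin U T × Lp ℝ 2 P) := {p | ∃ (s t : ℝ≥0) (u : U) (hst : s ≤ t), t ≤ T ∧
    p = (stepLp T s t u, (hW.memLp_increment hst u).toLp _)} with hG
  obtain ⟨I, hI⟩ := exists_linearIsometry_of_inner (G := G) (by
    rintro _ ⟨s, t, u, hst, htT, rfl⟩ _ ⟨s', t', u', hst', htT', rfl⟩
    rw [← inner_itoTerms hW T _ (const_stepLp_mem_itoTerms hW hst htT u) _
      (const_stepLp_mem_itoTerms hW hst' htT' u'), inner_const_Lp_two]) (by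
    refine (dense_span_stepLp (U := U) T).mono (Submodule.span_mono ?_)
    rintro _ ⟨s, t, u, hst, htT, rfl⟩
    exact ⟨_, ⟨s, t, u, hst, htT, rfl⟩, rfl⟩)
  exact ⟨I, fun s t u hst htT => hI _ ⟨s, t, u, hst, htT, rfl⟩⟩

/-- The Wiener integral `h ↦ W(h) = ∫₀ᵀ ⟨h(s), dW_s⟩` as a linear isometry. -/
def isonormal [CompleteSpace U] (hW : IsCylindricalWiener W 𝓕 P) (T : ℝ≥0) :
    CameronMartin U T →ₗᵢ[ℝ] Lp ℝ 2 P :=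
  (exists_isonormal hW T).choose

theorem isonormal_stepLp [CompleteSpace U] (hW : IsCylindricalWiener W 𝓕 P) {T s t : ℝ≥0}
    (hst : s ≤ t) (htT : t ≤ T) (u : U) :
    isonormal hW T (stepLp T s t u) =ᵐ[P] increment W s t u := by
  rw [isonormal, (exists_isonormal hW T).choose_spec s t u hst htT]
  exact (hW.memLp_increment hst u).coeFn_toLp

/-- The Itô integral of a deterministic integrand is its Wiener integral. -/
theorem isItoIntegral_const_iff [CompleteSpace U] (hW : IsCylindricalWiener W 𝓕 P) {T : ℝ≥0}
    (v : CameronMartin U T) (X : Lp ℝ 2 P) :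
    IsItoIntegral W 𝓕 P T (Lp.const 2 P v) X ↔ X = isonormal hW T v := by
  have hcont : Continuous fun φ : CameronMartin U T =>
      ((Lp.const 2 P φ, isonormal hW T φ) : Lp (CameronMartin U T) 2 P × Lp ℝ 2 P) :=
    (Lp.constL 2 P ℝ).continuous.prodMk (isonormal hW T).continuous
  -- Existence: both components are continuous in φ, so it suffices to check mesh step functions,
  -- which are elementary integrands.
  have hmem : ∀ φ : CameronMartin U T,
      (Lp.const 2 P φ, isonormal hW T φ) ∈ closure (elementaryItoGraph W 𝓕 P T) := by
    intro φ
    refine mem_of_isClosed_of_mesh (isClosed_closure.preimage hcont)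
      (fun N t u ht hN => subset_closure ?_) φ
    have htT : ∀ i : Fin N, t (i + 1) ≤ T := fun i => hN ▸ ht i.2
    refine ⟨N, fun i => t i, fun i => t (i + 1), fun i => u i, fun _ _ => 1, fun i =>
      ⟨ht (Nat.le_succ _), htT i⟩, fun i => ⟨measurable_const, 1, fun _ => by simp⟩, ?_, ?_⟩
    · filter_upwards [Lp.coeFn_const (p := 2) (μ := P)
        (c := ∑ k ∈ Finset.range N, stepLp T (t k) (t (k + 1)) (u k))] with ω h
      rw [h, Function.const_apply]
      have h1 : ∀ᵐ r ∂(timeMeasure T), ∀ k, stepLp T (t k) (t (k + 1)) (u k) r =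
          (Set.Ioc (t k : ℝ) (t (k + 1))).indicator (fun _ => u k) r :=
        ae_all_iff.2 fun k => stepLp_coeFn _ _ _ _
      filter_upwards [h1, Lp.coeFn_finsetSum (Finset.range N)
        fun k => stepLp T (t k) (t (k + 1)) (u k)] with r h2 h3
      rw [h3, Finset.sum_apply, Finset.sum_range]
      refine Finset.sum_congr rfl fun i _ => ?_
      rw [h2 i]; simp
    · have h1 : ∀ᵐ ω ∂P, ∀ i : Fin N, isonormal hW T (stepLp T (t i) (t (i + 1)) (u i)) ω =
          increment W (t i) (t (i + 1)) (u i) ω :=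
        ae_all_iff.2 fun i => isonormal_stepLp hW (ht (Nat.le_succ _)) (htT i) (u i)
      simp only [map_sum]
      filter_upwards [h1, Lp.coeFn_finsetSum (Finset.range N)
        fun k => isonormal hW T (stepLp T (t k) (t (k + 1)) (u k))] with ω h2 h3
      rw [h3, Finset.sum_apply, Finset.sum_range]
      refine Finset.sum_congr rfl fun i _ => ?_
      rw [h2 i]; simp [increment]
  have hle : closure (elementaryItoGraph W 𝓕 P T) ⊆
      (Submodule.span ℝ (itoTerms W 𝓕 P T)).topologicalClosure :=
    closure_mono (elementaryItoGraph_subset_span hW T)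
  constructor
  · intro h
    -- Uniqueness: (v, X) minus (v, W(v)) has first component 0, so its second component has norm 0.
    have h1 := norm_eq_of_mem_closure_span (inner_itoTerms hW T)
      (Submodule.sub_mem _ (hle h) (hle (hmem v)))
    simp only [Prod.mk_sub_mk, sub_self, norm_zero] at h1
    exact sub_eq_zero.1 (norm_eq_zero.1 h1.symm)
  · rintro rfl
    exact hmem v

end Ito

/-! ### Wiener integrals, scalar and as series along the basis. -/

section WienerIntegral

variable {Ω : Type*} {mΩ : MeasurableSpace Ω} {P : Measure Ω} {𝓕 : Filtration ℝ≥0 mΩ}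
  {U : Type*} [NormedAddCommGroup U] [InnerProductSpace ℝ U] {W : ℝ≥0 → U → Ω → ℝ}
  {K K' : Type*} [NormedAddCommGroup K] [InnerProductSpace ℝ K]
  [NormedAddCommGroup K'] [InnerProductSpace ℝ K'] {ι : Type*}

theorem compLp_mem_stepGraph {B : ℝ≥0 → Ω → ℝ} {T : ℝ≥0} (L : K →L[ℝ] K')
    {p : Lp K 2 (timeMeasure T) × Lp K 2 P} (hp : p ∈ stepGraph B P T) :
    (L.compLp p.1, L.compLp p.2) ∈ stepGraph B P T := by
  obtain ⟨n, s, t, y, hst, hp1, hp2⟩ := hp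
  refine ⟨n, s, t, fun i => L (y i), hst, ?_, ?_⟩
  · filter_upwards [hp1, L.coeFn_compLp p.1] with r h1 h2
    rw [h2, h1, map_sum]
    refine Finset.sum_congr rfl fun i _ => ?_
    by_cases hr : r ∈ Set.Ioc (s i : ℝ) (t i) <;> simp [hr]
  · filter_upwards [hp2, L.coeFn_compLp p.2] with ω h1 h2
    rw [h2, h1, map_sum]
    simp

theorem IsScalarWienerIntegral.compLp {B : ℝ≥0 → Ω → ℝ} {T : ℝ≥0} (L : K →L[ℝ] K') {φ : ℝ → K}
    {X : Lp K 2 P} (h : IsScalarWienerIntegral B P T φ X) :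
    IsScalarWienerIntegral B P T (fun s => L (φ s)) (L.compLp X) := by
  obtain ⟨hφ, hX⟩ := h
  refine ⟨L.comp_memLp' hφ, ?_⟩
  have hc : Continuous fun p : Lp K 2 (timeMeasure T) × Lp K 2 P =>
      ((L.compLp p.1, L.compLp p.2) : Lp K' 2 (timeMeasure T) × Lp K' 2 P) :=
    ((L.compLpL 2 (timeMeasure T)).continuous.comp continuous_fst).prodMk
      ((L.compLpL 2 P).continuous.comp continuous_snd)
  have h1 := map_mem_closure hc hX fun p hp => compLp_mem_stepGraph L hp
  convert h1 using 2
  refine Lp.ext ?_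
  filter_upwards [MemLp.coeFn_toLp (f := fun s => L (φ s)) (L.comp_memLp' hφ), L.coeFn_compLp (hφ.toLp φ),
    hφ.coeFn_toLp] with r h2 h3 h4
  rw [h2, h3, h4]

/-- Bounded operators commute with the integral of step functions, with closures and with sums.
Taking L = ⟨z, ·⟩ reduces the H-valued stochastic convolution to scalar integrals. -/
theorem IsWienerIntegral.compLp {T : ℝ≥0} {f : HilbertBasis ι ℝ U} (L : K →L[ℝ] K')
    {Φ : ℝ → U →L[ℝ] K} {X : Lp K 2 P} (h : IsWienerIntegral W P T f Φ X) :
    IsWienerIntegral W P T f (fun s => L.comp (Φ s)) (L.compLp X) := by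
  obtain ⟨I, hI, hX⟩ := h
  exact ⟨fun j => L.compLp (I j), fun j => (hI j).compLp L, (L.compLpL 2 P).hasSum hX⟩

variable [CompleteSpace U] [IsProbabilityMeasure P]

/-- Integrating φ against ⟨W, u⟩ is integrating φu against W. The continuous map J agrees with the
step integral on step functions, and its graph is closed; density of mesh step functions gives the
converse. -/
theorem isScalarWienerIntegral_iff (hW : IsCylindricalWiener W 𝓕 P) {T : ℝ≥0} (u : U)
    {φ : ℝ → ℝ} {X : Lp ℝ 2 P} (hφ : MemLp φ 2 (timeMeasure T)) :
    IsScalarWienerIntegral (fun t => W t u) P T φ X ↔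
      X = isonormal hW T ((ContinuousLinearMap.toSpanSingleton ℝ u).compLp (hφ.toLp φ)) := by
  set J : Lp ℝ 2 (timeMeasure T) → Lp ℝ 2 P := fun ψ =>
    isonormal hW T ((ContinuousLinearMap.toSpanSingleton ℝ u).compLp ψ) with hJ
  have hJc : Continuous J := (isonormal hW T).continuous.comp
    ((ContinuousLinearMap.toSpanSingleton ℝ u).compLpL 2 (timeMeasure T)).continuous
  have hJsum : ∀ (n : ℕ) (s t : Fin n → ℝ≥0) (y : Fin n → ℝ), (∀ i, s i ≤ t i ∧ t i ≤ T) →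
      ∀ ψ : Lp ℝ 2 (timeMeasure T), (ψ =ᵐ[timeMeasure T]
        fun r => ∑ i, (Set.Ioc (s i : ℝ) (t i)).indicator (fun _ => y i) r) →
      J ψ =ᵐ[P] fun ω => ∑ i, (W (t i) u ω - W (s i) u ω) • y i := by
    intro n s t y hst ψ hψ
    have h1 : (ContinuousLinearMap.toSpanSingleton ℝ u).compLp ψ =
        ∑ i, stepLp T (s i) (t i) (y i • u) := by
      refine Lp.ext ?_
      have h2 : ∀ᵐ r ∂(timeMeasure T), ∀ i, stepLp T (s i) (t i) (y i • u) r =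
          (Set.Ioc (s i : ℝ) (t i)).indicator (fun _ => y i • u) r :=
        ae_all_iff.2 fun i => stepLp_coeFn _ _ _ _
      filter_upwards [hψ, (ContinuousLinearMap.toSpanSingleton ℝ u).coeFn_compLp ψ, h2,
        Lp.coeFn_finsetSum Finset.univ fun i => stepLp T (s i) (t i) (y i • u)]
        with r h3 h4 h5 h6
      rw [h4, h3, h6, Finset.sum_apply, map_sum]
      refine Finset.sum_congr rfl fun i _ => ?_
      rw [h5 i]
      by_cases hr : r ∈ Set.Ioc (s i : ℝ) (t i) <;> simp [hr]
    have h2 : ∀ᵐ ω ∂P, ∀ i, isonormal hW T (stepLp T (s i) (t i) (y i • u)) ω =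
        (W (t i) u ω - W (s i) u ω) • y i := by
      refine ae_all_iff.2 fun i => ?_
      filter_upwards [isonormal_stepLp hW (hst i).1 (hst i).2 (y i • u),
        hW.increment_smul_ae (s i) (t i) (y i) u] with ω h3 h4
      rw [h3, h4, increment, smul_eq_mul, mul_comm]
    simp only [hJ, h1, map_sum]
    filter_upwards [h2, Lp.coeFn_finsetSum Finset.univ
      fun i => isonormal hW T (stepLp T (s i) (t i) (y i • u))] with ω h3 h4
    rw [h4, Finset.sum_apply]
    exact Finset.sum_congr rfl fun i _ => h3 i
  constructor
  · rintro ⟨_, hX⟩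
    have hc : IsClosed {p : Lp ℝ 2 (timeMeasure T) × Lp ℝ 2 P | p.2 = J p.1} :=
      isClosed_eq continuous_snd (hJc.comp continuous_fst)
    refine closure_minimal ?_ hc hX
    rintro p ⟨n, s, t, y, hst, hp1, hp2⟩
    exact Lp.ext (hp2.trans (hJsum n s t y hst p.1 hp1).symm)
  · rintro rfl
    refine ⟨hφ, ?_⟩
    refine mem_of_isClosed_of_mesh (E := ℝ) (isClosed_closure.preimage
      (continuous_id.prodMk hJc)) (fun N t y ht hN => subset_closure ?_) (hφ.toLp φ)
    have hst : ∀ i : Fin N, t i ≤ t (i + 1) ∧ t (i + 1) ≤ T :=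
      fun i => ⟨ht (Nat.le_succ _), hN ▸ ht i.2⟩
    have h1 : (∑ k ∈ Finset.range N, stepLp T (t k) (t (k + 1)) (y k) : CameronMartin ℝ T)
        =ᵐ[timeMeasure T] fun r =>
          ∑ i : Fin N, (Set.Ioc (t i : ℝ) (t (i + 1))).indicator (fun _ => y i) r := by
      have h2 : ∀ᵐ r ∂(timeMeasure T), ∀ k, stepLp T (t k) (t (k + 1)) (y k) r =
          (Set.Ioc (t k : ℝ) (t (k + 1))).indicator (fun _ => y k) r :=
        ae_all_iff.2 fun k => stepLp_coeFn _ _ _ _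
      filter_upwards [h2, Lp.coeFn_finsetSum (Finset.range N)
        fun k => stepLp T (t k) (t (k + 1)) (y k)] with r h3 h4
      rw [h4, Finset.sum_apply, Finset.sum_range]
      exact Finset.sum_congr rfl fun i _ => h3 i
    exact ⟨N, fun i => t i, fun i => t (i + 1), fun i => y i, hst, h1,
      hJsum N _ _ _ hst _ h1⟩

/-- The series expansion of the Wiener integral along an orthonormal basis. -/
theorem isWienerIntegral_iff [Countable ι] (hW : IsCylindricalWiener W 𝓕 P) {T : ℝ≥0}
    (f : HilbertBasis ι ℝ U) {v : ℝ → U} (hv : MemLp v 2 (timeMeasure T)) (X : Lp ℝ 2 P) :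
    IsWienerIntegral W P T f (fun s => innerSL ℝ (v s)) X ↔
      X = isonormal hW T (hv.toLp v) := by
  have hvj : ∀ j, MemLp (fun s => innerSL ℝ (v s) (f j)) 2 (timeMeasure T) := fun j => by
    have := (innerSL ℝ (f j)).comp_memLp' hv
    refine this.ae_eq (Eventually.of_forall fun s => ?_)
    simp [real_inner_comm]
  have hcoord : ∀ j, (ContinuousLinearMap.toSpanSingleton ℝ (f j)).compLp ((hvj j).toLp _) =
      (coordProj f j).compLp (hv.toLp v) := fun j => by
    refine Lp.ext ?_
    filter_upwards [(ContinuousLinearMap.toSpanSingleton ℝ (f j)).coeFn_compLp ((hvj j).toLp _),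
      (hvj j).coeFn_toLp, (coordProj f j).coeFn_compLp (hv.toLp v), hv.coeFn_toLp]
      with r h1 h2 h3 h4
    rw [h1, h2, h3, h4, coordProj_apply]
    simp [real_inner_comm]
  have hI : ∀ (j : ι) (Y : Lp ℝ 2 P),
      IsScalarWienerIntegral (fun t => W t (f j)) P T (fun s => innerSL ℝ (v s) (f j)) Y ↔
        Y = isonormal hW T ((coordProj f j).compLp (hv.toLp v)) := fun j Y => by
    rw [isScalarWienerIntegral_iff hW (f j) (hvj j), hcoord j]
  -- The isometry carries the basis expansion of v in L²([0,T];U) to a convergent series in L²(Ω).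
  have hsum : HasSum (fun j => isonormal hW T ((coordProj f j).compLp (hv.toLp v)))
      (isonormal hW T (hv.toLp v)) :=
    (isonormal hW T).toContinuousLinearMap.hasSum (hasSum_coordProj_compLp f (hv.toLp v))
  constructor
  · rintro ⟨I, hIj, hX⟩
    have : I = fun j => isonormal hW T ((coordProj f j).compLp (hv.toLp v)) :=
      funext fun j => (hI j (I j)).1 (hIj j)
    rw [this] at hX
    exact hX.unique hsum
  · rintro rfl
    exact ⟨_, fun j => (hI j _).2 rfl, hsum⟩

theorem isIsonormal_iff [Countable ι] (hW : IsCylindricalWiener W 𝓕 P) {T : ℝ≥0}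
    (f : HilbertBasis ι ℝ U) (h : CameronMartin U T) (X : Lp ℝ 2 P) :
    IsIsonormal W P T f h X ↔ X = isonormal hW T h := by
  rw [IsIsonormal, isWienerIntegral_iff hW f (Lp.memLp h), Lp.toLp_coeFn]

end WienerIntegral

/-! ### Stein's identity in one dimension. -/

section Stein

theorem hasDerivAt_gaussianPDFReal_std (x : ℝ) :
    HasDerivAt (gaussianPDFReal 0 1) (-(x * gaussianPDFReal 0 1 x)) x := by
  have h1 : HasDerivAt (fun x : ℝ => -(x - 0) ^ 2 / (2 * ((1 : ℝ≥0) : ℝ))) (-x) x := by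
    have := (((hasDerivAt_id x).sub_const 0).pow 2).neg.div_const (2 * ((1 : ℝ≥0) : ℝ))
    refine this.congr_deriv ?_
    simp
    ring
  have h2 := h1.exp.const_mul (√(2 * Real.pi * ((1 : ℝ≥0) : ℝ)))⁻¹
  refine h2.congr_deriv ?_
  simp only [gaussianPDFReal]
  ring

theorem integrable_gaussianReal_std_iff {f : ℝ → ℝ} :
    Integrable f (gaussianReal 0 1) ↔ Integrable fun x => f x * gaussianPDFReal 0 1 x := by
  rw [gaussianReal_of_var_ne_zero _ one_ne_zero,
    integrable_withDensity_iff (measurable_gaussianPDF _ _)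
      (ae_of_all _ fun _ => gaussianPDF_lt_top)]
  simp [toReal_gaussianPDF]

/-- Stein's identity for the standard Gaussian measure. -/
theorem integral_mul_id_gaussianReal_std {k k' : ℝ → ℝ} (hk : ∀ x, HasDerivAt k (k' x) x)
    (h0 : Integrable k (gaussianReal 0 1)) (h1 : Integrable (fun x => k x * x) (gaussianReal 0 1))
    (h2 : Integrable k' (gaussianReal 0 1)) :
    ∫ x, k x * x ∂(gaussianReal 0 1) = ∫ x, k' x ∂(gaussianReal 0 1) := by
  rw [integrable_gaussianReal_std_iff] at h0 h1 h2
  rw [integral_gaussianReal_eq_integral_smul one_ne_zero,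
    integral_gaussianReal_eq_integral_smul one_ne_zero]
  -- Integration by parts against the density p, with p'(x) = -x p(x). Integrability of kp removes
  -- the boundary terms.
  have h3 := integral_mul_deriv_eq_deriv_mul_of_integrable (u := k) (u' := k')
    (v := gaussianPDFReal 0 1) (v' := fun x => -(x * gaussianPDFReal 0 1 x))
    (fun x _ => hk x) (fun x _ => hasDerivAt_gaussianPDFReal_std x)
    (h1.neg.congr (Eventually.of_forall fun x => by simp [mul_assoc])) h2 h0
  have h4 : ∫ x, k x * -(x * gaussianPDFReal 0 1 x) =
      -∫ x, gaussianPDFReal 0 1 x • (k x * x) := by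
    rw [← integral_neg]
    refine integral_congr_ae (Eventually.of_forall fun x => ?_)
    simp only [smul_eq_mul]; ring
  rw [h4, neg_inj] at h3
  rw [h3]
  refine integral_congr_ae (Eventually.of_forall fun x => ?_)
  simp only [smul_eq_mul]; ring

end Stein

/-! ### W(h) is Gaussian, and orthogonality implies independence. -/

section Gaussian

variable {Ω : Type*} {mΩ : MeasurableSpace Ω} {P : Measure Ω} {𝓕 : Filtration ℝ≥0 mΩ}
  {U : Type*} [NormedAddCommGroup U] [InnerProductSpace ℝ U] {W : ℝ≥0 → U → Ω → ℝ}
  [IsProbabilityMeasure P]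

theorem integrable_cexp_mul_I {Z : Ω → ℝ} (hZ : AEStronglyMeasurable Z P) :
    Integrable (fun ω => Complex.exp (Z ω * Complex.I)) P := by
  refine Integrable.of_bound (C := 1) ?_ (Eventually.of_forall fun ω => ?_)
  · exact (Complex.continuous_exp.comp
      (Complex.continuous_ofReal.mul continuous_const)).comp_aestronglyMeasurable hZ
  · rw [Complex.norm_exp_ofReal_mul_I]

theorem integral_norm_le_norm_Lp_two (Z : Lp ℝ 2 P) : ∫ ω, ‖Z ω‖ ∂P ≤ ‖Z‖ := by
  rw [Lp.norm_def, integral_norm_eq_lintegral_enorm (Lp.aestronglyMeasurable Z),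
    ← eLpNorm_one_eq_lintegral_enorm]
  exact ENNReal.toReal_mono (Lp.eLpNorm_ne_top Z)
    (eLpNorm_le_eLpNorm_of_exponent_le (by norm_num) (Lp.aestronglyMeasurable Z))

/-- The map x ↦ exp(ix) is 1-Lipschitz and the L¹ norm is at most the L² norm. Identities between
characteristic functions thus become closed conditions in L²(Ω). -/
theorem continuous_integral_cexp_mul_I :
    Continuous fun Z : Lp ℝ 2 P => ∫ ω, Complex.exp (Z ω * Complex.I) ∂P := by
  refine LipschitzWith.continuous (K := 1) (LipschitzWith.of_dist_le_mul fun X Y => ?_)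
  rw [dist_eq_norm, dist_eq_norm, NNReal.coe_one, one_mul,
    ← integral_sub (integrable_cexp_mul_I (Lp.aestronglyMeasurable X))
      (integrable_cexp_mul_I (Lp.aestronglyMeasurable Y))]
  refine (norm_integral_le_integral_norm _).trans
    (le_trans ?_ (integral_norm_le_norm_Lp_two (X - Y)))
  refine integral_mono_ae ((integrable_cexp_mul_I (Lp.aestronglyMeasurable X)).sub
    (integrable_cexp_mul_I (Lp.aestronglyMeasurable Y))).norm
    ((Lp.memLp (X - Y)).integrable (by norm_num)).norm ?_
  filter_upwards [Lp.coeFn_sub X Y] with ω h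
  rw [h, Pi.sub_apply]
  have h1 : Complex.exp (X ω * Complex.I) - Complex.exp (Y ω * Complex.I) =
      Complex.exp (Y ω * Complex.I) *
        (Complex.exp (Complex.I * ((X ω - Y ω : ℝ) : ℂ)) - 1) := by
    rw [mul_sub, ← Complex.exp_add, mul_one]
    push_cast
    ring_nf
  rw [h1, norm_mul, Complex.norm_exp_ofReal_mul_I, one_mul]
  exact Real.norm_exp_I_mul_ofReal_sub_one_le

theorem IsCylindricalWiener.integral_cexp_increment (hW : IsCylindricalWiener W 𝓕 P) {s t : ℝ≥0}
    (hst : s ≤ t) (u : U) :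
    ∫ ω, Complex.exp (increment W s t u ω * Complex.I) ∂P =
      Complex.exp (-((‖u‖ ^ 2 * (t - s) : ℝ) : ℂ) / 2) := by
  have h1 := (hW.hasLaw_increment hst u).integral_comp
    (f := fun x : ℝ => Complex.exp (x * Complex.I)) (by fun_prop)
  simp only [Function.comp_def] at h1
  have h2 := charFun_gaussianReal (μ := 0) (v := ‖u‖₊ ^ 2 * (t - s)) 1
  rw [charFun_apply_real] at h2
  simp only [Complex.ofReal_one, one_mul, Complex.ofReal_zero, zero_mul, zero_sub, one_pow,
    mul_one] at h2
  rw [h1, h2]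
  congr 1
  push_cast [NNReal.coe_sub hst]
  ring

variable [CompleteSpace U]

/-- The characteristic function of `W(h)`. -/
theorem integral_cexp_isonormal (hW : IsCylindricalWiener W 𝓕 P) {T : ℝ≥0}
    (h : CameronMartin U T) :
    ∫ ω, Complex.exp (isonormal hW T h ω * Complex.I) ∂P =
      Complex.exp (-((‖h‖ ^ 2 : ℝ) : ℂ) / 2) := by
  refine mem_of_isClosed_of_mesh (C := {h | ∫ ω, Complex.exp (isonormal hW T h ω * Complex.I) ∂P =
      Complex.exp (-((‖h‖ ^ 2 : ℝ) : ℂ) / 2)}) (isClosed_eq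
      (continuous_integral_cexp_mul_I.comp (isonormal hW T).continuous) (by fun_prop))
      (fun N t u ht hN => ?_) h
  have htT : ∀ {n}, n ≤ N → t n ≤ T := fun hn => hN ▸ ht hn
  -- Induction on the number of intervals: the next increment is independent of the preceding sum,
  -- and its step function is orthogonal to the preceding ones, so both sides acquire the same
  -- factor.
  have key : ∀ n ≤ N,
      (∫ ω, Complex.exp ((∑ k ∈ Finset.range n, increment W (t k) (t (k + 1)) (u k) ω : ℝ) *
        Complex.I) ∂P = Complex.exp (-((‖(∑ k ∈ Finset.range n,
          stepLp T (t k) (t (k + 1)) (u k) : CameronMartin U T)‖ ^ 2 : ℝ) : ℂ) / 2)) := by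
    intro n
    induction n with
    | zero => intro _; simp
    | succ n ih =>
      intro hn
      have ih' := ih (Nat.le_of_succ_le hn)
      have hZ : Measurable[𝓕 (t n)]
          fun ω => ∑ k ∈ Finset.range n, increment W (t k) (t (k + 1)) (u k) ω :=
        Finset.measurable_sum _ fun k hk => hW.measurable_increment_filtration
          (ht (Nat.le_succ k)) (ht (Finset.mem_range.1 hk)) (u k)
      have hind := (hW.indepFun_increment (ht (Nat.le_succ n)) (u n) hZ).comp
        (φ := fun x : ℝ => Complex.exp (x * Complex.I))
        (ψ := fun x : ℝ => Complex.exp (x * Complex.I)) (by fun_prop) (by fun_prop)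
      have hmul := hind.integral_fun_mul_eq_mul_integral
        (integrable_cexp_mul_I
          (hZ.mono (𝓕.le _) le_rfl).aestronglyMeasurable).aestronglyMeasurable
        (integrable_cexp_mul_I
          (hW.measurable_increment _ _ (u n)).aestronglyMeasurable).aestronglyMeasurable
      simp only [Function.comp_def] at hmul
      have hL : ∫ ω, Complex.exp
          ((∑ k ∈ Finset.range (n + 1), increment W (t k) (t (k + 1)) (u k) ω : ℝ) *
            Complex.I) ∂P = ∫ ω, Complex.exp
          ((∑ k ∈ Finset.range n, increment W (t k) (t (k + 1)) (u k) ω : ℝ) * Complex.I) *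
            Complex.exp (increment W (t n) (t (n + 1)) (u n) ω * Complex.I) ∂P := by
        refine integral_congr_ae (Eventually.of_forall fun ω => ?_)
        simp only
        rw [Finset.sum_range_succ, ← Complex.exp_add, Complex.ofReal_add, add_mul]
      have horth : ⟪(∑ k ∈ Finset.range n, stepLp T (t k) (t (k + 1)) (u k) : CameronMartin U T),
          stepLp T (t n) (t (n + 1)) (u n)⟫_ℝ = 0 := by
        rw [sum_inner]
        refine Finset.sum_eq_zero fun k hk => ?_
        have hk' : k + 1 ≤ n := Finset.mem_range.1 hk
        rw [inner_stepLp (htT (hk'.trans (Nat.le_of_succ_le hn)))]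
        have : (Set.Ioc (t k : ℝ) (t (k + 1))) ∩ Set.Ioc (t n : ℝ) (t (n + 1)) = ∅ := by
          rw [Set.Ioc_inter_Ioc, Set.Ioc_eq_empty]
          have : (t (k + 1) : ℝ) ≤ t n := by exact_mod_cast ht hk'
          exact not_lt.2 (inf_le_left.trans (this.trans le_sup_right))
        simp [this]
      have hnorm : ‖stepLp T (t n) (t (n + 1)) (u n)‖ ^ 2 =
          ‖u n‖ ^ 2 * ((t (n + 1) : ℝ) - t n) := by
        rw [← real_inner_self_eq_norm_sq, inner_stepLp (htT hn), Set.inter_self,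
          Real.volume_real_Ioc_of_le (by exact_mod_cast ht (Nat.le_succ n)),
          real_inner_self_eq_norm_sq]
      rw [hL, hmul, ih', hW.integral_cexp_increment (ht (Nat.le_succ n)), ← Complex.exp_add,
        Finset.sum_range_succ _ n, norm_add_sq_real, horth, hnorm]
      congr 1
      push_cast
      ring
  rw [Set.mem_ofPred_eq, ← key N le_rfl]
  refine integral_congr_ae ?_
  have h1 : ∀ᵐ ω ∂P, ∀ k ∈ Finset.range N, isonormal hW T (stepLp T (t k) (t (k + 1)) (u k)) ω =
      increment W (t k) (t (k + 1)) (u k) ω :=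
    (ae_ball_iff (Finset.countable_toSet _)).2 fun k hk =>
      isonormal_stepLp hW (ht (Nat.le_succ k)) (htT (Finset.mem_range.1 hk)) (u k)
  simp only [map_sum]
  filter_upwards [h1, Lp.coeFn_finsetSum (Finset.range N)
    fun k => isonormal hW T (stepLp T (t k) (t (k + 1)) (u k))] with ω h2 h3
  rw [h3, Finset.sum_apply, Finset.sum_congr rfl h2]

/-- By linearity the characteristic function of W(v) at c is that of W(cv) at 1. -/
theorem hasLaw_isonormal (hW : IsCylindricalWiener W 𝓕 P) {T : ℝ≥0} {v : CameronMartin U T}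
    (hv : ‖v‖ = 1) : HasLaw (isonormal hW T v) (gaussianReal 0 1) P := by
  have hm := (Lp.aestronglyMeasurable (isonormal hW T v)).aemeasurable
  refine ⟨hm, ?_⟩
  have : IsProbabilityMeasure (P.map (isonormal hW T v)) := Measure.isProbabilityMeasure_map hm
  refine Measure.ext_of_charFun (funext fun c => ?_)
  rw [charFun_gaussianReal, charFun_apply_real, integral_map hm (by fun_prop)]
  have h1 := integral_cexp_isonormal hW (c • v)
  rw [norm_smul, hv, map_smul] at h1
  calc ∫ ω, Complex.exp (c * isonormal hW T v ω * Complex.I) ∂P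
      = ∫ ω, Complex.exp ((c • isonormal hW T v : Lp ℝ 2 P) ω * Complex.I) ∂P := by
        refine integral_congr_ae ?_
        filter_upwards [Lp.coeFn_smul c (isonormal hW T v)] with ω h
        rw [h]; simp
    _ = _ := by
        rw [h1]; simp [neg_div]

/-- The joint characteristic function is exp(-‖∑ cᵢ hᵢ + d v‖² / 2), which factorises by Pythagoras.
-/
theorem indepFun_isonormal (hW : IsCylindricalWiener W 𝓕 P) {T : ℝ≥0} {n : ℕ}
    (h : Fin n → CameronMartin U T) (v : CameronMartin U T) (hv : ∀ i, ⟪h i, v⟫_ℝ = 0) :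
    IndepFun (fun ω i => isonormal hW T (h i) ω) (isonormal hW T v) P := by
  have hm : ∀ g, AEMeasurable (isonormal hW T g) P :=
    fun g => (Lp.aestronglyMeasurable (isonormal hW T g)).aemeasurable
  have hm' : AEMeasurable (fun ω i => isonormal hW T (h i) ω) P :=
    aemeasurable_pi_lambda _ fun i => hm (h i)
  rw [indepFun_iff_charFunDual_prod hm' (hm v)]
  intro L
  set c : Fin n → ℝ := fun i => L (Pi.single i 1, 0) with hc
  set d : ℝ := L (0, 1) with hd
  have hLy : ∀ y : Fin n → ℝ, L (y, 0) = ∑ i, c i * y i := by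
    intro y
    have h1 : (y, (0 : ℝ)) = ∑ i, y i • ((Pi.single i 1 : Fin n → ℝ), (0 : ℝ)) := by
      refine Prod.ext ?_ ?_
      · rw [Prod.fst_sum]
        simpa using (pi_eq_sum_univ' y)
      · rw [Prod.snd_sum]; simp
    rw [h1, map_sum]
    refine Finset.sum_congr rfl fun i _ => ?_
    rw [map_smul, smul_eq_mul, mul_comm]
  have hLx : ∀ x : ℝ, L (0, x) = d * x := by
    intro x
    have h1 : ((0 : Fin n → ℝ), x) = x • ((0 : Fin n → ℝ), (1 : ℝ)) := by simp
    rw [h1, map_smul, smul_eq_mul, mul_comm]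
  have hLyx : ∀ y x, L (y, x) = ∑ i, c i * y i + d * x := by
    intro y x
    rw [← hLy, ← hLx, ← map_add]; simp
  have hsum : ∀ᵐ ω ∂P, isonormal hW T (∑ i, c i • h i) ω = ∑ i, c i * isonormal hW T (h i) ω := by
    have h2 : ∀ᵐ ω ∂P, ∀ i, (c i • isonormal hW T (h i) : Lp ℝ 2 P) ω =
        c i * isonormal hW T (h i) ω := ae_all_iff.2 fun i => by
      filter_upwards [Lp.coeFn_smul (c i) (isonormal hW T (h i))] with ω h3
      rw [h3]; simp
    simp only [map_sum, map_smul]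
    filter_upwards [h2, Lp.coeFn_finsetSum Finset.univ fun i => c i • isonormal hW T (h i)]
      with ω h3 h4
    rw [h4, Finset.sum_apply]
    exact Finset.sum_congr rfl fun i _ => h3 i
  have hsm : ∀ᵐ ω ∂P, isonormal hW T (d • v) ω = d * isonormal hW T v ω := by
    rw [map_smul]
    filter_upwards [Lp.coeFn_smul d (isonormal hW T v)] with ω h3
    rw [h3]; simp
  have e1 : charFunDual (P.map fun ω => ((fun i => isonormal hW T (h i) ω), isonormal hW T v ω)) L =
      Complex.exp (-((‖∑ i, c i • h i + d • v‖ ^ 2 : ℝ) : ℂ) / 2) := by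
    rw [← integral_cexp_isonormal hW, charFunDual_apply,
      integral_map (hm'.prodMk (hm v)) (by fun_prop)]
    refine integral_congr_ae ?_
    rw [map_add]
    filter_upwards [hsum, hsm, Lp.coeFn_add (isonormal hW T (∑ i, c i • h i))
      (isonormal hW T (d • v))] with ω h1 h2 h3
    rw [h3, Pi.add_apply, h1, h2, hLyx]
  have e2 : charFunDual (P.map fun ω i => isonormal hW T (h i) ω)
      (L.comp (.inl ℝ (Fin n → ℝ) ℝ)) =
      Complex.exp (-((‖∑ i, c i • h i‖ ^ 2 : ℝ) : ℂ) / 2) := by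
    rw [← integral_cexp_isonormal hW, charFunDual_apply, integral_map hm' (by fun_prop)]
    refine integral_congr_ae ?_
    filter_upwards [hsum] with ω h1
    rw [h1]
    simp [hLy]
  have e3 : charFunDual (P.map (isonormal hW T v)) (L.comp (.inr ℝ (Fin n → ℝ) ℝ)) =
      Complex.exp (-((‖d • v‖ ^ 2 : ℝ) : ℂ) / 2) := by
    rw [← integral_cexp_isonormal hW, charFunDual_apply, integral_map (hm v) (by fun_prop)]
    refine integral_congr_ae ?_
    filter_upwards [hsm] with ω h1
    rw [h1]
    simp [hLx]
  have horth : ⟪∑ i, c i • h i, d • v⟫_ℝ = 0 := by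
    rw [sum_inner]
    exact Finset.sum_eq_zero fun i _ => by
      rw [real_inner_smul_left, real_inner_smul_right, hv i]; simp
  rw [e1, e2, e3, ← Complex.exp_add, norm_add_sq_real, horth]
  congr 1
  push_cast
  ring

end Gaussian

/-! ### The σ-algebra of the noise. -/

section NoiseSigma

variable {Ω : Type*} {mΩ : MeasurableSpace Ω} {P : Measure Ω} {𝓕 : Filtration ℝ≥0 mΩ} {T : ℝ≥0}

theorem noiseSigma_le {U : Type*} [NormedAddCommGroup U] [InnerProductSpace ℝ U]
    {W : ℝ≥0 → U → Ω → ℝ} (hW : IsCylindricalWiener W 𝓕 P) : noiseSigma W T ≤ mΩ :=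
  iSup_le fun t => iSup_le fun _ => iSup_le fun u => (hW.measurable t u).comap_le

theorem measurable_noiseSigma {U : Type*} {W : ℝ≥0 → U → Ω → ℝ} {t : ℝ≥0} (ht : t ≤ T) (u : U) :
    Measurable[noiseSigma W T] (W t u) := by
  refine measurable_iff_comap_le.2 ?_
  exact le_iSup_of_le t (le_iSup_of_le ht (le_iSup
    (fun u => MeasurableSpace.comap (W t u) inferInstance) u))

end NoiseSigma

/-! ### Gaussian integration by parts and existence of the Skorokhod integral. -/

section IntegrationByParts

variable {Ω : Type*} {mΩ : MeasurableSpace Ω} {P : Measure Ω} {𝓕 : Filtration ℝ≥0 mΩ}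
  {U : Type*} [NormedAddCommGroup U] [InnerProductSpace ℝ U] {W : ℝ≥0 → U → Ω → ℝ}
  [IsProbabilityMeasure P] [CompleteSpace U] {T : ℝ≥0}

/-- Write hᵢ = h'ᵢ + aᵢ v with h'ᵢ orthogonal to v. Then W(v) is standard Gaussian and independent
of the vector W(h'). With W(h') = y frozen, Stein's identity applies to x ↦ g(y + x a), whose
derivative is the directional derivative of g along a. -/
theorem integral_mul_isonormal_of_norm_eq_one (hW : IsCylindricalWiener W 𝓕 P) {n : ℕ}
    (h : Fin n → CameronMartin U T) {v : CameronMartin U T} (hv : ‖v‖ = 1)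
    {g : (Fin n → ℝ) → ℝ} (hg : ContDiff ℝ 1 g)
    (h0 : Integrable (fun ω => g fun i => isonormal hW T (h i) ω) P)
    (h1 : Integrable (fun ω => g (fun i => isonormal hW T (h i) ω) * isonormal hW T v ω) P)
    (h2 : Integrable (fun ω => fderiv ℝ g (fun i => isonormal hW T (h i) ω)
      fun i => ⟪h i, v⟫_ℝ) P) :
    ∫ ω, g (fun i => isonormal hW T (h i) ω) * isonormal hW T v ω ∂P =
      ∫ ω, fderiv ℝ g (fun i => isonormal hW T (h i) ω) (fun i => ⟪h i, v⟫_ℝ) ∂P := by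
  set a : Fin n → ℝ := fun i => ⟪h i, v⟫_ℝ with ha
  set h' : Fin n → CameronMartin U T := fun i => h i - a i • v with hh'
  have horth : ∀ i, ⟪h' i, v⟫_ℝ = 0 := fun i => by
    rw [hh']
    simp only
    rw [inner_sub_left, real_inner_smul_left, real_inner_self_eq_norm_sq, hv]
    simp [ha]
  have hm : ∀ φ, AEMeasurable (isonormal hW T φ) P :=
    fun φ => (Lp.aestronglyMeasurable (isonormal hW T φ)).aemeasurable
  have hm' : AEMeasurable (fun ω i => isonormal hW T (h' i) ω) P :=
    aemeasurable_pi_lambda _ fun i => hm (h' i)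
  have hX : ∀ᵐ ω ∂P, (fun i => isonormal hW T (h i) ω) =
      (fun i => isonormal hW T (h' i) ω) + isonormal hW T v ω • a := by
    have h3 : ∀ᵐ ω ∂P, ∀ i, isonormal hW T (h i) ω =
        isonormal hW T (h' i) ω + isonormal hW T v ω * a i := ae_all_iff.2 fun i => by
      have h4 : isonormal hW T (h i) = isonormal hW T (h' i) + a i • isonormal hW T v := by
        rw [← map_smul, ← map_add]; simp [hh']
      filter_upwards [Lp.coeFn_add (isonormal hW T (h' i)) (a i • isonormal hW T v),
        Lp.coeFn_smul (a i) (isonormal hW T v)] with ω h5 h6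
      rw [h4, h5, Pi.add_apply, h6, Pi.smul_apply, smul_eq_mul, mul_comm]
    filter_upwards [h3] with ω h4
    funext i
    simp [h4 i]
  set ν : Measure (Fin n → ℝ) := P.map fun ω i => isonormal hW T (h' i) ω with hν
  have : IsProbabilityMeasure ν := Measure.isProbabilityMeasure_map hm'
  have hmap : P.map (fun ω => ((fun i => isonormal hW T (h' i) ω), isonormal hW T v ω)) =
      ν.prod (gaussianReal 0 1) := by
    rw [(indepFun_iff_map_prod_eq_prod_map_map hm' (hm v)).1 (indepFun_isonormal hW h' v horth),
      (hasLaw_isonormal hW hv).map_eq]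
  have htrans : ∀ ψ : (Fin n → ℝ) × ℝ → ℝ, Continuous ψ → ∀ χ : Ω → ℝ,
      (∀ᵐ ω ∂P, χ ω = ψ ((fun i => isonormal hW T (h' i) ω), isonormal hW T v ω)) →
      Integrable χ P → Integrable ψ (ν.prod (gaussianReal 0 1)) ∧
        ∫ ω, χ ω ∂P = ∫ p, ψ p ∂(ν.prod (gaussianReal 0 1)) := by
    intro ψ hψ χ hχ hi
    rw [← hmap, integral_map (hm'.prodMk (hm v)) hψ.aestronglyMeasurable,
      integrable_map_measure hψ.aestronglyMeasurable (hm'.prodMk (hm v))]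
    exact ⟨hi.congr hχ, integral_congr_ae hχ⟩
  have hgc : Continuous g := hg.continuous
  have hg'c : Continuous fun y => fderiv ℝ g y a := (hg.continuous_fderiv (by simp)).clm_apply
    continuous_const
  obtain ⟨i0, -⟩ := htrans (fun p => g (p.1 + p.2 • a)) (by fun_prop) _
    (by filter_upwards [hX] with ω h3; rw [h3]) h0
  obtain ⟨i1, e1⟩ := htrans (fun p => g (p.1 + p.2 • a) * p.2) (by fun_prop) _
    (by filter_upwards [hX] with ω h3; rw [h3]) h1
  obtain ⟨i2, e2⟩ := htrans (fun p => fderiv ℝ g (p.1 + p.2 • a) a)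
    (hg'c.comp (by fun_prop : Continuous fun p : (Fin n → ℝ) × ℝ => p.1 + p.2 • a)) _
    (by filter_upwards [hX] with ω h3; rw [h3]) h2
  -- Fubini, with the coordinate along v as the inner variable; the sections are integrable for
  -- almost every y.
  rw [e1, e2, integral_prod _ i1, integral_prod _ i2]
  refine integral_congr_ae ?_
  filter_upwards [i0.prod_right_ae, i1.prod_right_ae, i2.prod_right_ae] with y j0 j1 j2
  refine integral_mul_id_gaussianReal_std (fun x => ?_) j0 j1 j2
  have hd : HasDerivAt (fun x : ℝ => y + x • a) a x := by
    simpa using ((hasDerivAt_id x).smul_const a).const_add y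
  exact ((hg.differentiable (by simp)) _).hasFDerivAt.comp_hasDerivAt x hd

/-- Gaussian integration by parts. -/
theorem integral_mul_isonormal (hW : IsCylindricalWiener W 𝓕 P) {n : ℕ}
    (h : Fin n → CameronMartin U T) (v : CameronMartin U T)
    {g : (Fin n → ℝ) → ℝ} (hg : ContDiff ℝ 1 g)
    (h0 : MemLp (fun ω => g fun i => isonormal hW T (h i) ω) 2 P)
    (h2 : ∀ w : CameronMartin U T, Integrable (fun ω =>
      fderiv ℝ g (fun i => isonormal hW T (h i) ω) fun i => ⟪h i, w⟫_ℝ) P) :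
    ∫ ω, g (fun i => isonormal hW T (h i) ω) * isonormal hW T v ω ∂P =
      ∫ ω, fderiv ℝ g (fun i => isonormal hW T (h i) ω) (fun i => ⟪h i, v⟫_ℝ) ∂P := by
  rcases eq_or_ne v 0 with rfl | hv
  · have h3 : ∀ᵐ ω ∂P, g (fun i => isonormal hW T (h i) ω) * isonormal hW T 0 ω = 0 := by
      rw [map_zero]
      filter_upwards [Lp.coeFn_zero ℝ 2 P] with ω h4
      rw [h4]; simp
    have h4 : (fun i => ⟪h i, (0 : CameronMartin U T)⟫_ℝ) = 0 := by
      funext i; simp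
    rw [integral_congr_ae h3, h4]
    simp
  · have hv' : ‖v‖ ≠ 0 := norm_ne_zero_iff.2 hv
    set e := ‖v‖⁻¹ • v with he
    have hve : v = ‖v‖ • e := by rw [he, smul_inv_smul₀ hv']
    have he1 : ‖e‖ = 1 := by rw [he, norm_smul]; simp [hv']
    have h3 := integral_mul_isonormal_of_norm_eq_one hW h he1 hg (h0.integrable (by norm_num))
      (h0.integrable_mul (Lp.memLp (isonormal hW T e))) (h2 e)
    have h4 : ∀ᵐ ω ∂P, g (fun i => isonormal hW T (h i) ω) * isonormal hW T v ω =
        ‖v‖ * (g (fun i => isonormal hW T (h i) ω) * isonormal hW T e ω) := by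
      have h5 : isonormal hW T v = ‖v‖ • isonormal hW T e := by rw [← map_smul, ← hve]
      filter_upwards [Lp.coeFn_smul ‖v‖ (isonormal hW T e)] with ω h6
      rw [h5, h6, Pi.smul_apply, smul_eq_mul]; ring
    have h5 : (fun i => ⟪h i, v⟫_ℝ) = ‖v‖ • fun i => ⟪h i, e⟫_ℝ := by
      funext i
      conv_lhs => rw [hve]
      rw [real_inner_smul_right]; rfl
    rw [integral_congr_ae h4, integral_const_mul, h3, h5]
    simp_rw [map_smul, smul_eq_mul]
    rw [integral_const_mul]

theorem integral_inner_const_eq {E : Type*} [NormedAddCommGroup E] [InnerProductSpace ℝ E]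
    (G : Lp E 2 P) (v : E) :
    ∫ ω, ⟪G ω, Lp.const 2 P v ω⟫_ℝ ∂P = ∫ ω, ⟪G ω, v⟫_ℝ ∂P := by
  refine integral_congr_ae ?_
  filter_upwards [Lp.coeFn_const (p := 2) (μ := P) (c := v)] with ω h
  rw [h]; rfl

/-- The duality `E⟨DF, v⟩ = E[F W(v)]` for deterministic `v`. -/
theorem integral_inner_malliavinDeriv {ι : Type*} [Countable ι] (hW : IsCylindricalWiener W 𝓕 P)
    {f : HilbertBasis ι ℝ U} (v : CameronMartin U T) {F : Lp ℝ 2 P}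
    {G : Lp (CameronMartin U T) 2 P} (hFG : HasMalliavinDeriv W P T f F G) :
    ∫ ω, ⟪G ω, Lp.const 2 P v ω⟫_ℝ ∂P = ∫ ω, F ω * isonormal hW T v ω ∂P := by
  have hmul : ∀ F : Lp ℝ 2 P, ∫ ω, F ω * isonormal hW T v ω ∂P = ⟪isonormal hW T v, F⟫_ℝ := by
    intro F
    rw [L2.inner_def]
    refine integral_congr_ae (Eventually.of_forall fun ω => ?_)
    simp
  -- Both sides are L² inner products with a fixed element, so the duality is a closed condition on
  -- (F, DF) and only cylindrical functionals remain.
  have hc : IsClosed {p : Lp ℝ 2 P × Lp (CameronMartin U T) 2 P |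
      ∫ ω, ⟪p.2 ω, Lp.const 2 P v ω⟫_ℝ ∂P = ∫ ω, p.1 ω * isonormal hW T v ω ∂P} := by
    simp_rw [hmul, ← L2.inner_def]
    exact isClosed_eq (continuous_snd.inner continuous_const)
      (continuous_const.inner continuous_fst)
  refine closure_minimal ?_ hc hFG
  rintro p ⟨n, h, X, g, hX, hg, hp1, hp2⟩
  have hX' : ∀ i, X i = isonormal hW T (h i) := fun i => (isIsonormal_iff hW f (h i) (X i)).1 (hX i)
  simp only [hX'] at hp1 hp2
  have hder : ∀ w : CameronMartin U T, ∀ᵐ ω ∂P, ⟪p.2 ω, w⟫_ℝ =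
      fderiv ℝ g (fun i => isonormal hW T (h i) ω) fun i => ⟪h i, w⟫_ℝ := by
    intro w
    filter_upwards [hp2] with ω h1
    rw [h1, sum_inner]
    conv_rhs => rw [pi_eq_sum_univ' (fun i => ⟪h i, w⟫_ℝ), map_sum]
    refine Finset.sum_congr rfl fun i _ => ?_
    rw [real_inner_smul_left, map_smul, smul_eq_mul, mul_comm]
  rw [Set.mem_ofPred_eq, integral_inner_const_eq, integral_congr_ae (hder v)]
  -- The integrability conditions are read off from `p.1` and `p.2` being elements of L².
  rw [← integral_mul_isonormal hW h v (hg.1.of_le (by simp)) ((Lp.memLp p.1).ae_eq hp1) ?_]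
  · refine integral_congr_ae ?_
    filter_upwards [hp1] with ω h1
    rw [h1]
  · intro w
    have : Integrable (fun ω => ⟪p.2 ω, w⟫_ℝ) P :=
      ((Lp.memLp p.2).integrable (by norm_num)).inner_const w
    exact this.congr (hder w)

/-- Measurability with respect to a sub-σ-algebra is a closed condition in L² and holds for sums of
increments up to time T. -/
theorem aestronglyMeasurable_isonormal (hW : IsCylindricalWiener W 𝓕 P)
    (v : CameronMartin U T) : AEStronglyMeasurable[noiseSigma W T] (isonormal hW T v) P := by
  refine mem_of_isClosed_of_mesh (C := {v | AEStronglyMeasurable[noiseSigma W T]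
    (isonormal hW T v) P}) ((isClosed_aestronglyMeasurable (noiseSigma_le hW)).preimage
    (isonormal hW T).continuous) (fun N t u ht hN => ?_) v
  rw [Set.mem_ofPred_eq, map_sum, ← mem_lpMeas_iff_aestronglyMeasurable (𝕜 := ℝ)]
  refine Submodule.sum_mem _ fun k hk => mem_lpMeas_iff_aestronglyMeasurable.2 ?_
  have h2 : t (k + 1) ≤ T := hN ▸ ht (Finset.mem_range.1 hk)
  have h1 := ht (Nat.le_succ k)
  refine AEStronglyMeasurable.congr ?_ (isonormal_stepLp hW h1 h2 (u k)).symm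
  exact ((measurable_noiseSigma h2 (u k)).sub
    (measurable_noiseSigma (h1.trans h2) (u k))).stronglyMeasurable.aestronglyMeasurable

theorem isSkorokhodIntegral_const_isonormal {ι : Type*} [Countable ι]
    (hW : IsCylindricalWiener W 𝓕 P) (f : HilbertBasis ι ℝ U) (v : CameronMartin U T) :
    IsSkorokhodIntegral W P T f (Lp.const 2 P v) (isonormal hW T v) :=
  ⟨aestronglyMeasurable_isonormal hW v, fun _ _ hFG => integral_inner_malliavinDeriv hW v hFG⟩

end IntegrationByParts

/-! ### Sine and cosine as admissible test functions. -/

section Trigonometric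

theorem hasTemperateGrowth_of_abs_iteratedDeriv_le {φ : ℝ → ℝ} (hφ : ContDiff ℝ (⊤ : ℕ∞) φ)
    (hb : ∀ n x, |iteratedDeriv n φ x| ≤ 1) : φ.HasTemperateGrowth :=
  ⟨hφ, fun n => ⟨0, 1, fun x => by
    rw [norm_iteratedFDeriv_eq_norm_iteratedDeriv]; simpa using hb n x⟩⟩

theorem hasTemperateGrowth_sin : Real.sin.HasTemperateGrowth :=
  hasTemperateGrowth_of_abs_iteratedDeriv_le Real.contDiff_sin
    fun n x => Real.abs_iteratedDeriv_sin_le_one n x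

theorem hasTemperateGrowth_cos : Real.cos.HasTemperateGrowth :=
  hasTemperateGrowth_of_abs_iteratedDeriv_le Real.contDiff_cos
    fun n x => Real.abs_iteratedDeriv_cos_le_one n x

end Trigonometric

/-! ### Density of 𝔻^{1,2} and uniqueness of the Skorokhod integral. -/

section Uniqueness

variable {Ω : Type*} {mΩ : MeasurableSpace Ω} {P : Measure Ω} {𝓕 : Filtration ℝ≥0 mΩ}
  {U : Type*} [NormedAddCommGroup U] [InnerProductSpace ℝ U] {W : ℝ≥0 → U → Ω → ℝ}
  [IsProbabilityMeasure P] {T : ℝ≥0} {ι : Type*}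

/-- Two finite measures with densities `Y⁺` and `Y⁻` agree on the `σ`-algebra generated by a family
`Z` of random variables if `E[Y e^{i⟨c, Z⟩}] = 0` for all finite linear combinations. -/
theorem setIntegral_eq_zero_of_charFun {κ : Type*} {Z : κ → Ω → ℝ} (hZ : ∀ k, Measurable (Z k))
    {Y : Ω → ℝ} (hYm : Measurable Y) (hY : Integrable Y P)
    (hchar : ∀ (I : Finset κ) (c : I → ℝ),
      ∫ ω, (Y ω : ℂ) * Complex.exp ((∑ k, c k * Z k ω : ℝ) * Complex.I) ∂P = 0)
    {A : Set Ω} (hA : MeasurableSet[⨆ k, MeasurableSpace.comap (Z k) inferInstance] A) :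
    ∫ ω in A, Y ω ∂P = 0 := by
  classical
  have hpos : Measurable fun ω => (Y ω).toNNReal := hYm.real_toNNReal
  have hneg : Measurable fun ω => (-Y ω).toNNReal := hYm.neg.real_toNNReal
  have hposi : Integrable (fun ω => ((Y ω).toNNReal : ℝ)) P := hY.real_toNNReal
  have hnegi : Integrable (fun ω => ((-Y ω).toNNReal : ℝ)) P := hY.neg.real_toNNReal
  set Φ : Ω → κ → ℝ := fun ω k => Z k ω with hΦ
  have hΦm : Measurable Φ := measurable_pi_lambda _ hZ
  set μ : Measure Ω := P.withDensity fun ω => ((Y ω).toNNReal : ℝ≥0∞) with hμ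
  set ν : Measure Ω := P.withDensity fun ω => ((-Y ω).toNNReal : ℝ≥0∞) with hν
  have : IsFiniteMeasure μ := isFiniteMeasure_withDensity_ofReal hY.2
  have : IsFiniteMeasure ν := isFiniteMeasure_withDensity_ofReal hY.neg.2
  have heq : μ.map Φ = ν.map Φ := by
    -- The index set may be uncountable, so the two laws on ℝ^κ are compared through
    -- finite-dimensional marginals. The difference of the characteristic functions of these is the
    -- integral in `hchar`.
    refine IsProjectiveLimit.unique (P := fun I => (μ.map Φ).map I.restrict) (fun _ => rfl)
      fun I => ?_
    have hr : Measurable (I.restrict (π := fun _ : κ => ℝ)) := Finset.measurable_restrict I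
    simp only [Measure.map_map hr hΦm]
    symm
    refine Measure.ext_of_charFunDual (funext fun L => ?_)
    have hL : ∀ y : I → ℝ, L y = ∑ k, L (Pi.single k 1) * y k := by
      intro y
      conv_lhs => rw [pi_eq_sum_univ' y, map_sum]
      exact Finset.sum_congr rfl fun k _ => by rw [map_smul, smul_eq_mul, mul_comm]
    have hLω : ∀ ω, L ((I.restrict ∘ Φ) ω) = ∑ k : I, L (Pi.single k 1) * Z k ω :=
      fun ω => hL _
    rw [charFunDual_apply, charFunDual_apply,
      integral_map (hr.comp hΦm).aemeasurable (by fun_prop),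
      integral_map (hr.comp hΦm).aemeasurable (by fun_prop), hμ, hν,
      integral_withDensity_eq_integral_smul hpos,
      integral_withDensity_eq_integral_smul hneg, ← sub_eq_zero]
    have hE : Measurable fun ω => L ((I.restrict ∘ Φ) ω) :=
      L.continuous.measurable.comp (hr.comp hΦm)
    have hi : ∀ {D : Ω → ℝ≥0}, Integrable (fun ω => (D ω : ℝ)) P →
        Integrable (fun ω => D ω • Complex.exp (L ((I.restrict ∘ Φ) ω) * Complex.I)) P := by
      intro D hD
      have := hD.ofReal (𝕜 := ℂ)
      refine (this.mul_bdd (c := 1) (integrable_cexp_mul_I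
        hE.aestronglyMeasurable).aestronglyMeasurable (Eventually.of_forall fun ω => ?_)).congr
        (Eventually.of_forall fun ω => ?_)
      · rw [Complex.norm_exp_ofReal_mul_I]
      · simp [NNReal.smul_def]
    rw [← integral_sub (hi hposi) (hi hnegi),
      ← hchar I fun k => L (Pi.single k 1)]
    refine integral_congr_ae (Eventually.of_forall fun ω => ?_)
    simp only
    rw [hLω, NNReal.smul_def, NNReal.smul_def, ← sub_smul, Real.coe_toNNReal', Real.coe_toNNReal',
      max_zero_sub_max_neg_zero_eq_self, Complex.real_smul]
  have hA' : MeasurableSet[MeasurableSpace.comap Φ inferInstance] A := by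
    refine (iSup_le fun k => ?_ : (⨆ k, MeasurableSpace.comap (Z k) inferInstance) ≤
      MeasurableSpace.comap Φ inferInstance) A hA
    exact measurable_iff_comap_le.1 ((measurable_pi_apply k).comp (comap_measurable Φ))
  obtain ⟨B, hB, rfl⟩ := hA'
  have h1 : μ (Φ ⁻¹' B) = ν (Φ ⁻¹' B) := by
    rw [← Measure.map_apply hΦm hB, ← Measure.map_apply hΦm hB, heq]
  rw [hμ, hν, withDensity_apply _ (hΦm hB), withDensity_apply _ (hΦm hB)] at h1
  rw [integral_eq_lintegral_pos_part_sub_lintegral_neg_part hY.integrableOn]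
  simp only [ENNReal.ofReal]
  rw [h1, sub_self]

variable [CompleteSpace U]

/-- Since W₀ = 0 almost surely, the values of W are increments from 0. Hence the variables
exp(iW(h)) include every exponential needed in `setIntegral_eq_zero_of_charFun`. -/
theorem isonormal_sum_smul_stepLp (hW : IsCylindricalWiener W 𝓕 P) {κ : Type*} [Fintype κ]
    (t : κ → ℝ≥0) (ht : ∀ k, t k ≤ T) (u : κ → U) (c : κ → ℝ) :
    isonormal hW T (∑ k, c k • stepLp T 0 (t k) (u k)) =ᵐ[P] fun ω => ∑ k, c k * W (t k) (u k) ω := by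
  have h0 : ∀ u : U, ∀ᵐ ω ∂P, W 0 u ω = 0 := by
    intro u
    rcases eq_or_ne u 0 with rfl | hu
    · filter_upwards [hW.smul_ae 0 0 0] with ω h1
      simpa using h1
    · have hu' : ‖u‖ ≠ 0 := norm_ne_zero_iff.2 hu
      have h1 : ‖(‖u‖⁻¹ • u)‖ = 1 := by rw [norm_smul]; simp [hu']
      have h2 := hW.smul_ae 0 ‖u‖ (‖u‖⁻¹ • u)
      rw [smul_inv_smul₀ hu'] at h2
      filter_upwards [h2, (hW.brownian _ h1).eval_zero_ae_eq_zero] with ω h3 h4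
      rw [h3, h4, mul_zero]
  have h1 : ∀ᵐ ω ∂P, ∀ k, (c k • isonormal hW T (stepLp T 0 (t k) (u k)) : Lp ℝ 2 P) ω =
      c k * W (t k) (u k) ω := ae_all_iff.2 fun k => by
    filter_upwards [Lp.coeFn_smul (c k) (isonormal hW T (stepLp T 0 (t k) (u k))),
      isonormal_stepLp hW zero_le (ht k) (u k), h0 (u k)] with ω h2 h3 h4
    rw [h2, Pi.smul_apply, h3, smul_eq_mul, increment, h4, sub_zero]
  simp only [map_sum, map_smul]
  filter_upwards [h1, Lp.coeFn_finsetSum Finset.univ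
    fun k => c k • isonormal hW T (stepLp T 0 (t k) (u k))] with ω h2 h3
  rw [h3, Finset.sum_apply]
  exact Finset.sum_congr rfl fun k _ => h2 k

variable [Countable ι]

/-- The chain rule for cylindrical functionals of one variable, needed for the sine and cosine in
the density argument and for an affine φ in the mild solution. -/
theorem hasMalliavinDeriv_comp_isonormal (hW : IsCylindricalWiener W 𝓕 P)
    (f : HilbertBasis ι ℝ U) (h : CameronMartin U T) {φ : ℝ → ℝ} (hφ : φ.HasTemperateGrowth)
    {F : Lp ℝ 2 P} {G : Lp (CameronMartin U T) 2 P}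
    (hF : F =ᵐ[P] fun ω => φ (isonormal hW T h ω))
    (hG : G =ᵐ[P] fun ω => deriv φ (isonormal hW T h ω) • h) : HasMalliavinDeriv W P T f F G := by
  refine subset_closure ⟨1, fun _ => h, fun _ => isonormal hW T h, fun x => φ (x 0),
    fun _ => (isIsonormal_iff hW f h _).2 rfl, ?_, hF, ?_⟩
  · exact hφ.comp (ContinuousLinearMap.proj (R := ℝ) (φ := fun _ : Fin 1 => ℝ) 0).hasTemperateGrowth
  · filter_upwards [hG] with ω h1
    rw [h1, Fin.sum_univ_one]
    have h2 : HasFDerivAt (fun x : Fin 1 → ℝ => φ (x 0))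
        (deriv φ (isonormal hW T h ω) • ContinuousLinearMap.proj (R := ℝ) (φ := fun _ : Fin 1 => ℝ) 0)
        (fun _ => isonormal hW T h ω) := by
      have h3 : HasDerivAt φ (deriv φ (isonormal hW T h ω)) (isonormal hW T h ω) :=
        (hφ.1.differentiable (by simp) _).hasDerivAt
      exact h3.comp_hasFDerivAt (fun _ : Fin 1 => isonormal hW T h ω)
        (ContinuousLinearMap.proj (R := ℝ) (φ := fun _ : Fin 1 => ℝ) 0).hasFDerivAt
    rw [h2.fderiv]
    simp

theorem exists_hasMalliavinDeriv_of_bounded (hW : IsCylindricalWiener W 𝓕 P)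
    (f : HilbertBasis ι ℝ U) (h : CameronMartin U T) {φ : ℝ → ℝ} (hφ : φ.HasTemperateGrowth)
    (hb : ∀ x, |φ x| ≤ 1) (hb' : ∀ x, |deriv φ x| ≤ 1) :
    ∃ F G, HasMalliavinDeriv W P T f F G ∧ F =ᵐ[P] fun ω => φ (isonormal hW T h ω) := by
  have hm := Lp.aestronglyMeasurable (isonormal hW T h)
  have h1 : MemLp (fun ω => φ (isonormal hW T h ω)) 2 P :=
    MemLp.of_bound (hφ.1.continuous.comp_aestronglyMeasurable hm) 1
      (Eventually.of_forall fun ω => hb _)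
  have h2 : MemLp (fun ω => deriv φ (isonormal hW T h ω) • h) 2 P := by
    refine MemLp.of_bound (((hφ.1.continuous_deriv (by simp)).comp_aestronglyMeasurable
      hm).smul_const h) ‖h‖ (Eventually.of_forall fun ω => ?_)
    rw [norm_smul]
    exact mul_le_of_le_one_left (norm_nonneg _) (hb' _)
  exact ⟨h1.toLp _, h2.toLp _, hasMalliavinDeriv_comp_isonormal hW f h hφ h1.coeFn_toLp
    h2.coeFn_toLp, h1.coeFn_toLp⟩

/-- `𝔻^{1,2}` is dense in `L²` of the `σ`-algebra generated by the noise. -/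
theorem eq_zero_of_forall_hasMalliavinDeriv (hW : IsCylindricalWiener W 𝓕 P)
    (f : HilbertBasis ι ℝ U) {Y : Lp ℝ 2 P} (hYm : AEStronglyMeasurable[noiseSigma W T] Y P)
    (hY : ∀ F G, HasMalliavinDeriv W P T f F G → ∫ ω, F ω * Y ω ∂P = 0) : Y = 0 := by
  have hYi : Integrable Y P := (Lp.memLp Y).integrable (by norm_num)
  have htrig : ∀ (h : CameronMartin U T) {φ : ℝ → ℝ}, φ.HasTemperateGrowth → (∀ x, |φ x| ≤ 1) →
      (∀ x, |deriv φ x| ≤ 1) → ∫ ω, Y ω * φ (isonormal hW T h ω) ∂P = 0 := by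
    intro h φ hφ hb hb'
    obtain ⟨F, G, hFG, hF⟩ := exists_hasMalliavinDeriv_of_bounded hW f h hφ hb hb'
    rw [← hY F G hFG]
    refine integral_congr_ae ?_
    filter_upwards [hF] with ω h1
    rw [h1, mul_comm]
  have hexp : ∀ h : CameronMartin U T,
      ∫ ω, (Y ω : ℂ) * Complex.exp (isonormal hW T h ω * Complex.I) ∂P = 0 := by
    intro h
    have hm := Lp.aestronglyMeasurable (isonormal hW T h)
    have hc := htrig h hasTemperateGrowth_cos Real.abs_cos_le_one
      (fun x => by simpa using Real.abs_sin_le_one x)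
    have hs := htrig h hasTemperateGrowth_sin Real.abs_sin_le_one
      (fun x => by simpa using Real.abs_cos_le_one x)
    have ic : Integrable (fun ω => Y ω * Real.cos (isonormal hW T h ω)) P :=
      hYi.mul_bdd (c := 1) (Real.continuous_cos.comp_aestronglyMeasurable hm)
        (Eventually.of_forall fun ω => Real.abs_cos_le_one _)
    have is : Integrable (fun ω => Y ω * Real.sin (isonormal hW T h ω)) P :=
      hYi.mul_bdd (c := 1) (Real.continuous_sin.comp_aestronglyMeasurable hm)
        (Eventually.of_forall fun ω => Real.abs_sin_le_one _)
    calc ∫ ω, (Y ω : ℂ) * Complex.exp (isonormal hW T h ω * Complex.I) ∂P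
        = ∫ ω, (((Y ω * Real.cos (isonormal hW T h ω) : ℝ) : ℂ) +
            ((Y ω * Real.sin (isonormal hW T h ω) : ℝ) : ℂ) * Complex.I) ∂P := by
          refine integral_congr_ae (Eventually.of_forall fun ω => ?_)
          simp only
          rw [Complex.exp_mul_I]
          push_cast
          ring
      _ = 0 := by
          rw [integral_add ic.ofReal (is.ofReal.mul_const _), integral_mul_const,
            integral_complex_ofReal, integral_complex_ofReal, hc, hs]
          simp
  set Z : {t : ℝ≥0 // t ≤ T} × U → Ω → ℝ := fun k => W k.1 k.2 with hZ
  have hle : noiseSigma W T ≤ ⨆ k, MeasurableSpace.comap (Z k) inferInstance :=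
    iSup_le fun t => iSup_le fun ht => iSup_le fun u =>
      le_iSup (fun k => MeasurableSpace.comap (Z k) inferInstance) (⟨t, ht⟩, u)
  have hset : ∀ A, MeasurableSet[noiseSigma W T] A → ∫ ω in A, Y ω ∂P = 0 := by
    intro A hA
    refine setIntegral_eq_zero_of_charFun (Z := Z) (fun k => hW.measurable k.1 k.2)
      (Lp.stronglyMeasurable Y).measurable hYi (fun I c => ?_) (hle A hA)
    rw [← hexp (∑ k : I, c k • stepLp T 0 k.1.1 k.1.2)]
    refine integral_congr_ae ?_
    filter_upwards [isonormal_sum_smul_stepLp hW (fun k : I => (k.1.1 : ℝ≥0)) (fun k => k.1.1.2)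
      (fun k => k.1.2) c] with ω h1
    rw [h1]
  -- Vanishing integrals over noise events suffice because Y is itself measurable with respect to
  -- the noise.
  exact (Lp.eq_zero_iff_ae_eq_zero).2 (Lp.ae_eq_zero_of_forall_setIntegral_eq_zero' ℝ
    (noiseSigma_le hW) Y (by norm_num) (by norm_num) (fun _ _ _ => hYi.integrableOn)
    (fun A hA _ => hset A hA) hYm)

/-- The Skorokhod integral of a deterministic integrand is its Wiener integral. -/
theorem isSkorokhodIntegral_const_iff (hW : IsCylindricalWiener W 𝓕 P) (f : HilbertBasis ι ℝ U)
    (v : CameronMartin U T) (X : Lp ℝ 2 P) :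
    IsSkorokhodIntegral W P T f (Lp.const 2 P v) X ↔ X = isonormal hW T v := by
  refine ⟨fun hX => ?_, fun h => h ▸ isSkorokhodIntegral_const_isonormal hW f v⟩
  have hI := isSkorokhodIntegral_const_isonormal hW f v
  -- Two candidates have the same pairing with every F in 𝔻^{1,2}, and their difference is
  -- measurable with respect to the noise.
  refine sub_eq_zero.1 (eq_zero_of_forall_hasMalliavinDeriv (T := T) hW f ?_ fun F G hFG => ?_)
  · exact (hX.1.sub hI.1).congr (Lp.coeFn_sub _ _).symm
  · have h1 : ∀ᵐ ω ∂P, F ω * (X - isonormal hW T v) ω =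
        F ω * X ω - F ω * isonormal hW T v ω := by
      filter_upwards [Lp.coeFn_sub X (isonormal hW T v)] with ω h2
      rw [h2, Pi.sub_apply, mul_sub]
    have hi : ∀ Y : Lp ℝ 2 P, Integrable (fun ω => F ω * Y ω) P :=
      fun Y => (Lp.memLp F).integrable_mul (Lp.memLp Y)
    rw [integral_congr_ae h1, integral_sub (hi _) (hi _), ← hX.2 F G hFG, ← hI.2 F G hFG, sub_self]

end Uniqueness

/-! ### Hilbert–Schmidt bounds and measurability of operator fields. -/

section OperatorFields

variable {α : Type*} {mα : MeasurableSpace α} {ι : Type*}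
  {U : Type*} [NormedAddCommGroup U] [InnerProductSpace ℝ U]
  {K : Type*} [NormedAddCommGroup K] [InnerProductSpace ℝ K]

/-- Parseval for R* y, with ⟨fⱼ, R* y⟩ = ⟨R fⱼ, y⟩ and Cauchy–Schwarz in each term. -/
theorem norm_adjoint_apply_sq_le [CompleteSpace U] [CompleteSpace K] (f : HilbertBasis ι ℝ U)
    {R : U →L[ℝ] K} (hR : IsHilbertSchmidt f R) (y : K) :
    ‖ContinuousLinearMap.adjoint R y‖ ^ 2 ≤ hsNormSq f R * ‖y‖ ^ 2 := by
  have h1 := f.hasSum_inner_mul_inner (ContinuousLinearMap.adjoint R y)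
    (ContinuousLinearMap.adjoint R y)
  rw [real_inner_self_eq_norm_sq] at h1
  rw [hsNormSq, ← tsum_mul_right]
  refine hasSum_le (fun j => ?_) h1 (hR.mul_right _).hasSum
  rw [real_inner_comm, ← sq, ContinuousLinearMap.adjoint_inner_right, ← mul_pow, ← sq_abs]
  gcongr
  exact abs_real_inner_le_norm _ _

variable [Countable ι]

/-- Expand v(a) along the basis and take pointwise limits of finite sums. This asks only for strong
measurability of Φ on basis vectors, all that strong continuity of a semigroup provides;
operator-norm measurability may fail. -/
theorem stronglyMeasurable_clm_apply (f : HilbertBasis ι ℝ U) {Φ : α → U →L[ℝ] K}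
    (hΦ : ∀ j, StronglyMeasurable fun a => Φ a (f j)) {v : α → U}
    (hv : ∀ j, StronglyMeasurable fun a => ⟪f j, v a⟫_ℝ) :
    StronglyMeasurable fun a => Φ a (v a) := by
  refine stronglyMeasurable_of_tendsto (atTop : Filter (Finset ι))
    (f := fun s a => ∑ j ∈ s, ⟪f j, v a⟫_ℝ • Φ a (f j)) (fun s => ?_) ?_
  · exact Finset.stronglyMeasurable_fun_sum s fun j _ => (hv j).smul (hΦ j)
  · refine tendsto_pi_nhds.2 fun a => ?_
    have h := (Φ a).hasSum (f.hasSum_repr (v a))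
    simp only [f.repr_apply_apply, map_smul] at h
    exact h

theorem stronglyMeasurable_adjoint_apply [CompleteSpace U] [CompleteSpace K]
    (f : HilbertBasis ι ℝ U) {Φ : α → U →L[ℝ] K} (hΦ : ∀ j, StronglyMeasurable fun a => Φ a (f j))
    (x : K) : StronglyMeasurable fun a => ContinuousLinearMap.adjoint (Φ a) x := by
  refine stronglyMeasurable_clm_apply f (Φ := fun _ => ContinuousLinearMap.id ℝ U)
    (fun j => stronglyMeasurable_const) fun j => ?_
  have h : (fun a => ⟪f j, ContinuousLinearMap.adjoint (Φ a) x⟫_ℝ) =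
      fun a => ⟪Φ a (f j), x⟫_ℝ :=
    funext fun a => ContinuousLinearMap.adjoint_inner_right (Φ a) (f j) x
  exact h ▸ (hΦ j).inner stronglyMeasurable_const

end OperatorFields

/-! ### Semigroup estimates and the mild solution. -/

section Semigroup

variable {H : Type*} [NormedAddCommGroup H] [InnerProductSpace ℝ H]
  {U : Type*} [NormedAddCommGroup U] [InnerProductSpace ℝ U]
  {S : ℝ≥0 → H →L[ℝ] H} {M ω₀ : ℝ} {T : ℝ≥0}

theorem IsC0Semigroup.continuous_apply_sub (hS : IsC0Semigroup S) (T : ℝ≥0) (x : H) :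
    Continuous fun r : ℝ => S (T - r).toNNReal x :=
  (hS.continuous_apply x).comp (continuous_real_toNNReal.comp (continuous_const.sub continuous_id))

theorem norm_semigroup_sub_le
    (hSM : ∀ (t : ℝ≥0) (x : H), ‖S t x‖ ≤ M * Real.exp (ω₀ * t) * ‖x‖) (hM : 0 ≤ M) {r : ℝ}
    (hr : r ∈ Set.Icc (0 : ℝ) T) :
    ‖S (T - r).toNNReal‖ ≤ M * Real.exp (ω₀ * (T - r)) := by
  refine ContinuousLinearMap.opNorm_le_bound _ (by positivity) fun x => ?_
  have := hSM (T - r).toNNReal x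
  rwa [Real.coe_toNNReal _ (sub_nonneg.2 hr.2)] at this

theorem exp_mul_sub_le (ω₀ : ℝ) {r : ℝ} (hr : r ∈ Set.Icc (0 : ℝ) T) :
    Real.exp (ω₀ * (T - r)) ≤ Real.exp (|ω₀| * T) := by
  have h1 : 0 ≤ (T : ℝ) - r := sub_nonneg.2 hr.2
  have h2 : (T : ℝ) - r ≤ T := by linarith [hr.1]
  exact Real.exp_le_exp.2 ((mul_le_mul_of_nonneg_right (le_abs_self _) h1).trans
    (mul_le_mul_of_nonneg_left h2 (abs_nonneg _)))

theorem integral_exp_mul_sub_le (ω₀ : ℝ) (T : ℝ≥0) :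
    ∫ r in (0 : ℝ)..T, Real.exp (2 * ω₀ * (T - r)) ≤
      if ω₀ = 0 then (T : ℝ) else |Real.exp (2 * ω₀ * T) - 1| / (2 * |ω₀|) := by
  split_ifs with h
  · simp [h]
  · have h1 := intervalIntegral.integral_comp_sub_left (a := 0) (b := (T : ℝ))
      (fun s => Real.exp (2 * ω₀ * s)) (T : ℝ)
    have h2 : (2 * ω₀) ≠ 0 := mul_ne_zero two_ne_zero h
    rw [h1, intervalIntegral.integral_comp_mul_left (fun s => Real.exp s) h2, integral_exp]
    simp only [sub_self, sub_zero, mul_zero, Real.exp_zero, smul_eq_mul]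
    -- Nothing is lost here: exp(2ω₀T) - 1 and 2ω₀ do not have opposite signs.
    refine (le_abs_self _).trans (le_of_eq ?_)
    rw [abs_mul, abs_inv, abs_mul, abs_two, inv_mul_eq_div]

theorem stronglyMeasurable_semigroup_comp (hS : IsC0Semigroup S) (T : ℝ≥0) (R : U →L[ℝ] H)
    (u : U) :
    StronglyMeasurable fun r : ℝ => ((S (T - r).toNNReal).comp R) u :=
  (hS.continuous_apply_sub T (R u)).stronglyMeasurable

variable {ι : Type*} {f : HilbertBasis ι ℝ U} {R : U →L[ℝ] H}
  {Ω : Type*} {mΩ : MeasurableSpace Ω} {P : Measure Ω} [IsProbabilityMeasure P]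

theorem lintegral_tsum_enorm_semigroup_lt_top (hR : IsHilbertSchmidt f R) (hM : 0 ≤ M)
    (hSM : ∀ (t : ℝ≥0) (x : H), ‖S t x‖ ≤ M * Real.exp (ω₀ * t) * ‖x‖) :
    ∫⁻ p, ∑' j, ‖((S (T - p.2).toNNReal).comp R) (f j)‖ₑ ^ 2 ∂(P.prod (timeMeasure T)) < ∞ := by
  -- C bounds ‖S(t)‖ on [0,T] whatever the sign of ω₀, so the Hilbert–Schmidt series has a majorant
  -- independent of time.
  set C := M * Real.exp (|ω₀| * T) with hC
  have hC0 : 0 ≤ C := by positivity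
  have hsum : ∑' j, ENNReal.ofReal (C ^ 2 * ‖R (f j)‖ ^ 2) < ∞ :=
    ((hR.mul_left (C ^ 2)).tsum_ofReal_ne_top).lt_top
  have hmem : ∀ᵐ p ∂(P.prod (timeMeasure T)), p.2 ∈ Set.Icc (0 : ℝ) T :=
    Measure.quasiMeasurePreserving_snd.ae (ae_restrict_mem measurableSet_Icc)
  refine (lintegral_mono_ae (g := fun _ => ∑' j, ENNReal.ofReal (C ^ 2 * ‖R (f j)‖ ^ 2))
    ?_).trans_lt ?_
  · filter_upwards [hmem] with p hp
    refine ENNReal.tsum_le_tsum fun j => ?_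
    rw [← ofReal_norm, ← ENNReal.ofReal_pow (norm_nonneg _), ← mul_pow]
    refine ENNReal.ofReal_le_ofReal ?_
    gcongr
    refine (ContinuousLinearMap.le_opNorm (S (T - p.2).toNNReal) (R (f j))).trans ?_
    gcongr
    exact (norm_semigroup_sub_le hSM hM hp).trans
      (mul_le_mul_of_nonneg_left (exp_mul_sub_le ω₀ hp) hM)
  · rw [lintegral_const]
    exact ENNReal.mul_lt_top hsum (measure_lt_top _ _)

theorem integrable_semigroup_comp_apply [Countable ι] (hS : IsC0Semigroup S)
    (f : HilbertBasis ι ℝ U)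
    (hM : 0 ≤ M) (hSM : ∀ (t : ℝ≥0) (x : H), ‖S t x‖ ≤ M * Real.exp (ω₀ * t) * ‖x‖) {v : ℝ → U}
    (hvm : StronglyMeasurable v) (hv : MemLp v 2 (timeMeasure T)) :
    Integrable (fun r : ℝ => ((S (T - r).toNNReal).comp R) (v r)) (timeMeasure T) := by
  have hm : StronglyMeasurable fun r : ℝ => ((S (T - r).toNNReal).comp R) (v r) :=
    stronglyMeasurable_clm_apply f (fun j => stronglyMeasurable_semigroup_comp hS T R (f j))
      fun j => stronglyMeasurable_const.inner hvm
  refine ((hv.integrable (by norm_num)).norm.const_mul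
    (M * Real.exp (|ω₀| * T) * ‖R‖)).mono' hm.aestronglyMeasurable ?_
  filter_upwards [ae_restrict_mem measurableSet_Icc] with r hr
  refine (ContinuousLinearMap.le_opNorm _ _).trans ?_
  refine mul_le_mul_of_nonneg_right ?_ (norm_nonneg _)
  refine (ContinuousLinearMap.opNorm_comp_le _ _).trans ?_
  gcongr
  exact (norm_semigroup_sub_le hSM hM hr).trans
    (mul_le_mul_of_nonneg_left (exp_mul_sub_le ω₀ hr) hM)

variable [CompleteSpace H] [CompleteSpace U]

theorem norm_adjoint_semigroup_sq_le (hR : IsHilbertSchmidt f R) (hM : 0 ≤ M)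
    (hSM : ∀ (t : ℝ≥0) (x : H), ‖S t x‖ ≤ M * Real.exp (ω₀ * t) * ‖x‖) (x : H) {r : ℝ}
    (hr : r ∈ Set.Icc (0 : ℝ) T) :
    ‖ContinuousLinearMap.adjoint ((S (T - r).toNNReal).comp R) x‖ ^ 2 ≤
      hsNormSq f R * M ^ 2 * ‖x‖ ^ 2 * Real.exp (2 * ω₀ * (T - r)) := by
  rw [ContinuousLinearMap.adjoint_comp, ContinuousLinearMap.comp_apply]
  refine (norm_adjoint_apply_sq_le f hR _).trans ?_
  have h0 : 0 ≤ hsNormSq f R := tsum_nonneg fun j => sq_nonneg _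
  have h1 : ‖ContinuousLinearMap.adjoint (S (T - r).toNNReal) x‖ ≤
      M * Real.exp (ω₀ * (T - r)) * ‖x‖ := by
    refine (ContinuousLinearMap.le_opNorm _ _).trans ?_
    rw [LinearIsometryEquiv.norm_map]
    gcongr
    exact norm_semigroup_sub_le hSM hM hr
  have h2 : Real.exp (2 * ω₀ * (T - r)) = Real.exp (ω₀ * (T - r)) ^ 2 := by
    rw [← Real.exp_nat_mul]; congr 1; push_cast; ring
  rw [h2]
  calc hsNormSq f R * ‖ContinuousLinearMap.adjoint (S (T - r).toNNReal) x‖ ^ 2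
      ≤ hsNormSq f R * (M * Real.exp (ω₀ * (T - r)) * ‖x‖) ^ 2 := by gcongr
    _ = _ := by ring

theorem integral_norm_adjoint_semigroup_sq_le
    (hR : IsHilbertSchmidt f R) (hM : 0 ≤ M)
    (hSM : ∀ (t : ℝ≥0) (x : H), ‖S t x‖ ≤ M * Real.exp (ω₀ * t) * ‖x‖) (x : H)
    (hv : MemLp (fun r : ℝ => ContinuousLinearMap.adjoint ((S (T - r).toNNReal).comp R) x) 2
      (timeMeasure T)) :
    ∫ r in (0 : ℝ)..T, ‖ContinuousLinearMap.adjoint ((S (T - r).toNNReal).comp R) x‖ ^ 2 ≤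
      hsNormSq f R * M ^ 2 * ‖x‖ ^ 2 *
        (if ω₀ = 0 then (T : ℝ) else |Real.exp (2 * ω₀ * T) - 1| / (2 * |ω₀|)) := by
  have h0 : 0 ≤ hsNormSq f R := tsum_nonneg fun j => sq_nonneg _
  have hi : IntervalIntegrable
      (fun r : ℝ => ‖ContinuousLinearMap.adjoint ((S (T - r).toNNReal).comp R) x‖ ^ 2)
      volume 0 T :=
    (intervalIntegrable_iff_integrableOn_Icc_of_le T.2).2 hv.norm.integrable_sq
  refine (intervalIntegral.integral_mono_on T.2 hi (Continuous.intervalIntegrable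
    (by fun_prop) _ _) fun r hr => norm_adjoint_semigroup_sq_le hR hM hSM x hr).trans ?_
  rw [intervalIntegral.integral_const_mul]
  gcongr
  exact integral_exp_mul_sub_le ω₀ T

variable [Countable ι]

theorem memLp_adjoint_semigroup (hS : IsC0Semigroup S) (f : HilbertBasis ι ℝ U) (R : U →L[ℝ] H)
    (hM : 0 ≤ M) (hSM : ∀ (t : ℝ≥0) (x : H), ‖S t x‖ ≤ M * Real.exp (ω₀ * t) * ‖x‖) (x : H) :
    MemLp (fun r : ℝ => ContinuousLinearMap.adjoint ((S (T - r).toNNReal).comp R) x) 2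
      (timeMeasure T) := by
  refine MemLp.of_bound (stronglyMeasurable_adjoint_apply f (fun j =>
    stronglyMeasurable_semigroup_comp hS T R (f j)) x).aestronglyMeasurable
    (‖R‖ * (M * Real.exp (|ω₀| * T)) * ‖x‖) ?_
  filter_upwards [ae_restrict_mem measurableSet_Icc] with r hr
  refine (ContinuousLinearMap.le_opNorm _ _).trans ?_
  rw [LinearIsometryEquiv.norm_map]
  refine mul_le_mul_of_nonneg_right ?_ (norm_nonneg _)
  refine (ContinuousLinearMap.opNorm_comp_le _ _).trans ?_
  rw [mul_comm]
  gcongr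
  exact (norm_semigroup_sub_le hSM hM hr).trans
    (mul_le_mul_of_nonneg_left (exp_mul_sub_le ω₀ hr) hM)

/-- `⟨u(T), z⟩ = ⟨S(T) u₀, z⟩ + W(R* S(T - ·)* z)`. -/
theorem IsMildSolutionAt.inner_ae_eq {𝓕 : Filtration ℝ≥0 mΩ} {W : ℝ≥0 → U → Ω → ℝ}
    (hW : IsCylindricalWiener W 𝓕 P) {u₀ : H} {uT : Lp H 2 P}
    (huT : IsMildSolutionAt W P T f S R u₀ uT) (z : H)
    (hz : MemLp (fun r : ℝ => ContinuousLinearMap.adjoint ((S (T - r).toNNReal).comp R) z) 2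
      (timeMeasure T)) :
    ∀ᵐ ω ∂P, ⟪uT ω, z⟫_ℝ = ⟪S T u₀, z⟫_ℝ + isonormal hW T (hz.toLp _) ω := by
  obtain ⟨Z, hZ, hu⟩ := huT
  -- Testing against z turns the operator-valued integrand into the functional represented by (S(T -
  -- s) R)* z.
  have h1 := hZ.compLp (innerSL ℝ z)
  have h2 : (fun s : ℝ => (innerSL ℝ z).comp ((S ((T : ℝ) - s).toNNReal).comp R)) =
      fun s : ℝ => innerSL ℝ (ContinuousLinearMap.adjoint ((S (T - s).toNNReal).comp R) z) := by
    funext s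
    ext u
    simp [ContinuousLinearMap.adjoint_inner_left]
  rw [h2, isWienerIntegral_iff hW f hz] at h1
  rw [← h1]
  filter_upwards [hu, (innerSL ℝ z).coeFn_compLp Z] with ω h3 h4
  rw [h3, h4, inner_add_left, innerSL_apply_apply, real_inner_comm z (Z ω)]

/-- ⟨u(T), z⟩ is the affine function x ↦ ⟨S(T)u₀, z⟩ + x of a single W(h), so it is itself
cylindrical with constant derivative h. -/
theorem IsMildSolutionAt.exists_hasMalliavinDeriv {𝓕 : Filtration ℝ≥0 mΩ} {W : ℝ≥0 → U → Ω → ℝ}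
    (hW : IsCylindricalWiener W 𝓕 P) {u₀ : H} {uT : Lp H 2 P}
    (huT : IsMildSolutionAt W P T f S R u₀ uT) (z : H)
    (hz : MemLp (fun r : ℝ => ContinuousLinearMap.adjoint ((S (T - r).toNNReal).comp R) z) 2
      (timeMeasure T)) :
    ∃ F : Lp ℝ 2 P, (F =ᵐ[P] fun ω => ⟪uT ω, z⟫_ℝ) ∧
      HasMalliavinDeriv W P T f F (Lp.const 2 P (hz.toLp _)) := by
  have hF : MemLp (fun ω => ⟪uT ω, z⟫_ℝ) 2 P := (Lp.memLp uT).inner_const z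
  refine ⟨hF.toLp _, hF.coeFn_toLp, hasMalliavinDeriv_comp_isonormal hW f (hz.toLp _)
    (φ := fun x => ⟪S T u₀, z⟫_ℝ + x)
    ((Function.HasTemperateGrowth.const _).add Function.HasTemperateGrowth.id') ?_ ?_⟩
  · exact hF.coeFn_toLp.trans (huT.inner_ae_eq hW z hz)
  · filter_upwards [Lp.coeFn_const (p := 2) (μ := P) (c := hz.toLp _)] with ω h
    rw [h]
    simp

end Semigroup

end LinearSPDE

end

/-! ### The covering vector field: assembly of the three claims. -/

theorem theorem4
    {H : Type*} [NormedAddCommGroup H] [InnerProductSpace ℝ H] [CompleteSpace H]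
    [TopologicalSpace.SeparableSpace H]
    {U : Type*} [NormedAddCommGroup U] [InnerProductSpace ℝ U] [CompleteSpace U]
    [TopologicalSpace.SeparableSpace U]
    -- the filtered probability space and the cylindrical Wiener process
    {Ω : Type*} {mΩ : MeasurableSpace Ω} (P : Measure Ω) [IsProbabilityMeasure P]
    (𝓕 : Filtration ℝ≥0 mΩ)
    (W : ℝ≥0 → U → Ω → ℝ) (hW : LinearSPDE.IsCylindricalWiener W 𝓕 P)
    {ι : Type*} [Countable ι] (f : HilbertBasis ι ℝ U)
    -- the drift operator and its semigroup
    (A : H →ₗ.[ℝ] H) (hA : Dense (A.domain : Set H))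
    (S : ℝ≥0 → H →L[ℝ] H) (hS : LinearSPDE.IsC0Semigroup S) (hAS : LinearSPDE.IsGenerator A S)
    (M ω₀ : ℝ) (hM : 1 ≤ M) (hSM : ∀ (t : ℝ≥0) (x : H), ‖S t x‖ ≤ M * Real.exp (ω₀ * t) * ‖x‖)
    -- the operator `Q^{1/2}`
    (R : U →L[ℝ] H) (hR : LinearSPDE.IsHilbertSchmidt f R)
    -- the mild solution at time `T`
    (T : ℝ≥0) (hT : 0 < T) (u₀ : H) (uT : Lp H 2 P)
    (huT : LinearSPDE.IsMildSolutionAt W P T f S R u₀ uT)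
    (h : (LinearSPDE.pinv (LinearSPDE.malliavinCovariance S R T)).domain) :
    ∃ hv : MemLp (LinearSPDE.coveringField S R T h) 2 (LinearSPDE.timeMeasure T),
      -- adaptedness
      StronglyAdapted 𝓕 (fun (r : ℝ≥0) (_ : Ω) => LinearSPDE.coveringField S R T h r) ∧
      -- the `L²` bound
      (∫ r in (0 : ℝ)..T, ‖LinearSPDE.coveringField S R T h r‖ ^ 2 ≤
        LinearSPDE.hsNormSq f R * M ^ 2 *
          ‖LinearSPDE.pinv (LinearSPDE.malliavinCovariance S R T) h‖ ^ 2 *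
          (if ω₀ = 0 then (T : ℝ) else |Real.exp (2 * ω₀ * T) - 1| / (2 * |ω₀|))) ∧
      -- the Skorokhod, Itô and Wiener integrals exist, are unique and coincide
      (∃ I : Lp ℝ 2 P,
        (∀ X : Lp ℝ 2 P,
          LinearSPDE.IsSkorokhodIntegral W P T f (Lp.const 2 P (hv.toLp _)) X ↔ X = I) ∧
        (∀ X : Lp ℝ 2 P,
          LinearSPDE.IsItoIntegral W 𝓕 P T (Lp.const 2 P (hv.toLp _)) X ↔ X = I) ∧
        (∀ X : Lp ℝ 2 P,
          LinearSPDE.IsWienerIntegral W P T f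
            (fun r => innerSL ℝ (LinearSPDE.coveringField S R T h r)) X ↔ X = I)) ∧
      -- the Malliavin derivative of the solution and its pairing with the covering vector field
      LinearSPDE.IsMalliavinDerivField W P T f uT (fun _ r => (S (T - r).toNNReal).comp R) ∧
      IntegrableOn (fun r : ℝ => S (T - r).toNNReal (R (LinearSPDE.coveringField S R T h r)))
        (Set.Icc (0 : ℝ) T) ∧
      LinearSPDE.IsDerivPairing W P T f uT (hv.toLp _) (fun _ =>
        ∫ r in (0 : ℝ)..T, S (T - r).toNNReal (R (LinearSPDE.coveringField S R T h r))) := by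
  have hM0 : 0 ≤ M := zero_le_one.trans hM
  set x := LinearSPDE.pinv (LinearSPDE.malliavinCovariance S R T) h with hx
  have hcov : LinearSPDE.coveringField S R T h =
      fun r : ℝ => ContinuousLinearMap.adjoint ((S (T - r).toNNReal).comp R) x := by
    funext r
    rw [ContinuousLinearMap.adjoint_comp]
    rfl
  rw [hcov]
  -- Kept for an arbitrary vector: at x it concerns the covering field, at z the derivative of
  -- ⟨u(T), z⟩.
  have hmem := LinearSPDE.memLp_adjoint_semigroup (T := T) hS f R hM0 hSM
  have hint : IntegrableOn (fun r : ℝ => S (T - r).toNNReal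
      (R (ContinuousLinearMap.adjoint ((S (T - r).toNNReal).comp R) x))) (Set.Icc (0 : ℝ) T) :=
    LinearSPDE.integrable_semigroup_comp_apply hS f hM0 hSM
      (LinearSPDE.stronglyMeasurable_adjoint_apply f (fun j =>
        LinearSPDE.stronglyMeasurable_semigroup_comp hS T R (f j)) x) (hmem x)
  refine ⟨hmem x, fun r => stronglyMeasurable_const,
    LinearSPDE.integral_norm_adjoint_semigroup_sq_le hR hM0 hSM x (hmem x),
    ⟨LinearSPDE.isonormal hW T ((hmem x).toLp _),
      LinearSPDE.isSkorokhodIntegral_const_iff hW f _, LinearSPDE.isItoIntegral_const_iff hW _,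
      LinearSPDE.isWienerIntegral_iff hW f (hmem x)⟩,
    ⟨fun j => ?_, LinearSPDE.lintegral_tsum_enorm_semigroup_lt_top hR hM0 hSM, fun z => ?_⟩,
    hint, fun z => ?_⟩
  · exact ((LinearSPDE.stronglyMeasurable_semigroup_comp hS T R (f j)).comp_measurable
      measurable_snd).aestronglyMeasurable
  · obtain ⟨F, hF, hFG⟩ := huT.exists_hasMalliavinDeriv hW z (hmem z)
    refine ⟨F, _, hF, ?_, hFG⟩
    filter_upwards [Lp.coeFn_const (p := 2) (μ := P) (c := (hmem z).toLp _)] with ω h1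
    rw [h1]
    exact (hmem z).coeFn_toLp
  · obtain ⟨F, hF, hFG⟩ := huT.exists_hasMalliavinDeriv hW z (hmem z)
    refine ⟨F, _, hF, hFG, ?_⟩
    filter_upwards [Lp.coeFn_const (p := 2) (μ := P) (c := (hmem z).toLp _)] with ω h1
    -- The inner product with z passes inside the Bochner integral, and the adjoint then moves S(T -
    -- r) R from one factor to the other.
    rw [h1, Function.const_apply, L2.inner_def, real_inner_comm,
      intervalIntegral.integral_of_le T.coe_nonneg, ← integral_Icc_eq_integral_Ioc,
      ← integral_inner hint]
    refine integral_congr_ae ?_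
    filter_upwards [(hmem z).coeFn_toLp, (hmem x).coeFn_toLp] with r h2 h3
    rw [h2, h3, ContinuousLinearMap.adjoint_inner_left, ContinuousLinearMap.comp_apply]
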